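/- Let $(r,\theta)$ be polar coordinates in $\mathbb{R}^2$, $\bm e_r=(\cos\theta,\sin\theta)$, $\bm e_\theta=(-\sin\theta,\cos\theta)$. Let $\theta_0\in(0,2\pi]$ and let $\Omega=\{(r,\theta): 1<r<2,\ 0<\theta<\theta_0\}$ be the truncated sector. Let $\bm u=u_\theta\bm e_\theta+u_r\bm e_r$ be of class $C^2$ up to the boundary of $\Omega$, in the sense that $u_r,u_\theta$, as functions of $(r,\theta)$, belong to $C^2([1,2]\times[0,\theta_0])$ (for $\theta_0=2\pi$ the edges $\theta=0$ and $\theta=\theta_0$ are regarded as distinct), and let $(\bm u,P)$, with a differentiable pressure $P$ in $\Omega$, solve the stationary Euler equations $$\bm u\cdot\nabla\bm u=-\nabla P,\qquad \operatorname{div}\bm u=0\qquad\text{in }\Omega .$$ Suppose that $|u_r|>0$ on $[1,2]\times[0,\theta_0]$, and that for some constants $c_1,c_2$ $$u_\theta(r,0)=\frac{c_1}{r},\quad u_\theta(r,\theta_0)=\frac{c_2}{r}\quad(1\le r\le 2),$$ $$u_r(1,\theta)=2u_r(2,\theta),\quad u_\theta(1,\theta)=2u_\theta(2,\theta),\quad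 \partial_r u_\theta(1,\theta)=4\,\partial_r u_\theta(2,\theta)\quad(0\le\theta\le\theta_0).$$ Then $c_1=c_2=:c$, and the following hold. (i) If $c=0$, then $\bm u$ is $(-1)$-homogeneous, $P$ is $(-2)$-homogeneous up to an additive constant, and there are constants $b\neq0$ and $C$ such that $$\bm u=\frac{b}{r}\,\bm e_r,\qquad P=-\frac{b^2}{2r^2}+C .$$ (ii) If $c\neq0$ and $\partial_\theta(ru_r)$ is constant along $\theta=0$ or constant along $\theta=\theta_0$ (for $1\le r\le2$), then $\bm u$ is $(-1)$-homogeneous, $P$ is $(-2)$-homogeneous up to an additive constant, and there are constants $p$, $C$ and a function $f\in C^2([0,\theta_0])$, which is either everywhere positive or everywhere negative on $[0,\theta_0]$, such that $$\bm u=\frac{c}{r}\,\bm e_\theta+\frac{f(\theta)}{r}\,\bm e_r,\qquad P=\frac{p}{r^2}+C,\qquad c f'(\theta)=f(\theta)^2+c^2+2p\quad\text{on }[0,\theta_0].$$ -/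

import Mathlib

open Real Set

/-- The Euclidean plane. -/
abbrev Plane : Type := EuclideanSpace ℝ (Fin 2)

noncomputable section

/-- The radial unit vector at polar angle `θ`. -/
def eR (θ : ℝ) : Plane := !₂[Real.cos θ, Real.sin θ]

/-- The angular unit vector at polar angle `θ`. -/
def eTheta (θ : ℝ) : Plane := !₂[-Real.sin θ, Real.cos θ]

/-- The point of the plane with polar coordinates `q = (r, θ)`. -/
def polarPoint (q : ℝ × ℝ) : Plane := q.1 • eR q.2

/-- The open rectangle `a < r < b`, `0 < θ < θ₀` of polar coordinates. -/
def openRect (a b θ₀ : ℝ) : Set (ℝ × ℝ) := Ioo a b ×ˢ Ioo 0 θ₀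

/-- The closed rectangle `a ≤ r ≤ b`, `0 ≤ θ ≤ θ₀` of polar coordinates. It represents the closed
truncated sector; the two straight edges `θ = 0` and `θ = θ₀` stay distinct when `θ₀ = 2π`. -/
def closedRect (a b θ₀ : ℝ) : Set (ℝ × ℝ) := Icc a b ×ˢ Icc 0 θ₀

/-- The open truncated sector, as a subset of the plane. -/
def sector (a b θ₀ : ℝ) : Set Plane := polarPoint '' openRect a b θ₀

/-- The divergence of a planar vector field. -/
def divergence (u : Plane → Plane) (x : Plane) : ℝ :=
  ∑ i : Fin 2, fderiv ℝ u x (EuclideanSpace.single i 1) i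

/-- `(u, P)` solves the stationary incompressible Euler equations `u · ∇u = -∇P`, `div u = 0`
in the open set `Ω`. -/
def IsEulerSolution (Ω : Set Plane) (u : Plane → Plane) (P : Plane → ℝ) : Prop :=
  DifferentiableOn ℝ u Ω ∧ DifferentiableOn ℝ P Ω ∧
    ∀ x ∈ Ω, fderiv ℝ u x (u x) = -gradient P x ∧ divergence u x = 0

/-- The field `u` on the open truncated sector is `C²` up to the boundary, with polar components
`uᵣ`, `uθ` (functions of `(r, θ)` on the closed rectangle; their values at boundary points are
the boundary values of the components of `u`). -/
def IsC2WithPolarComponents (a b θ₀ : ℝ) (u : Plane → Plane) (ur uθ : ℝ × ℝ → ℝ) : Prop :=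
  ContDiffOn ℝ 2 ur (closedRect a b θ₀) ∧ ContDiffOn ℝ 2 uθ (closedRect a b θ₀) ∧
    ∀ q ∈ openRect a b θ₀, u (polarPoint q) = uθ q • eTheta q.2 + ur q • eR q.2

/-- `F` is homogeneous of degree `k` on `Ω`. -/
def IsHomogeneousOn {E : Type*} [AddCommGroup E] [Module ℝ E] (k : ℤ) (F : Plane → E)
    (Ω : Set Plane) : Prop :=
  ∀ x ∈ Ω, ∀ t : ℝ, 0 < t → t • x ∈ Ω → F (t • x) = t ^ k • F x

/-- On the truncated sector, `u` is `(-1)`-homogeneous, `P` is `(-2)`-homogeneous up to an additive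
constant `C`, and `u = (v(θ)/r) e_θ + (f(θ)/r) e_r`, `P = p / r² + C`. The formula for `u` is
required up to the boundary. -/
def HasHomogeneousForm (a b θ₀ : ℝ) (u : Plane → Plane) (ur uθ : ℝ × ℝ → ℝ) (P : Plane → ℝ)
    (v f : ℝ → ℝ) (p : ℝ) : Prop :=
  IsHomogeneousOn (-1) u (sector a b θ₀) ∧
  (∀ q ∈ closedRect a b θ₀, uθ q = v q.2 / q.1 ∧ ur q = f q.2 / q.1) ∧
  ∃ C : ℝ, IsHomogeneousOn (-2) (fun x => P x - C) (sector a b θ₀) ∧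
    ∀ q ∈ openRect a b θ₀, P (polarPoint q) = p / q.1 ^ 2 + C

end

/-! Put t = log r, v = r u_θ, w = r u_r and T = log 2. The conditions relating r = 1 and r = 2 say
that v, w and v_t are T-periodic in t, while v equals c₁ and c₂ on the edges. The Euler system
becomes w_t + v_θ = 0 together with w ζ_t + v ζ_θ = 2 w ζ for ζ = v_t - w_θ. A (-1)-homogeneous
field is one for which v and w do not depend on t, so the task is to show that v is constant.
Integrating the divergence gives c₁ = c₂ = c.

Two divergence identities carry the proof: each exhibits a nonnegative quantity as the divergence of
a field whose boundary fluxes cancel (`divergence_eq_zero_of_nonneg`).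

In `eq_zero_of_energy_identity` the quotient φ = v/w makes sense because w ≠ 0. The divergence
equation gives Δv = ζ_t and Δw = -ζ_θ, hence div(w²∇φ) = wΔv - vΔw = w ζ_t + v ζ_θ. If this equals
2αwζ, then w²|∇φ|² is an exact divergence, because 2αvζ = -α div(w² - v², 2vw). If v = 0 on both
edges, φ is constant and v = 0. Case (i) is α = 1.

For c ≠ 0 let ψ satisfy ψ_t = c - v and ψ_θ = w. It is periodic, constant on each edge, and grows
along the flow at rate cw. Therefore h = ζ exp(-2ψ/c) is transported by (w, v). The assumption in
(ii) makes h constant on one edge, and `eq_const_of_transport` spreads this to the whole rectangle.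
Then c ζ_θ = 2wζ, so w ζ_t + (v - c) ζ_θ = 0, and the energy identity with α = 0, applied to v - c,
yields v = c.

Once v = c, w depends on θ alone and the vorticity equation integrates to c w' = w² + c² + 2p, with
p the pressure coefficient. -/

/-! ### Calculus on closed rectangles -/

/-- The partial derivative within `S` in the first variable. -/
noncomputable def partialFst (S : Set (ℝ × ℝ)) (f : ℝ × ℝ → ℝ) (q : ℝ × ℝ) : ℝ :=
  fderivWithin ℝ f S q (1, 0)

/-- The partial derivative within `S` in the second variable. -/
noncomputable def partialSnd (S : Set (ℝ × ℝ)) (f : ℝ × ℝ → ℝ) (q : ℝ × ℝ) : ℝ :=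
  fderivWithin ℝ f S q (0, 1)

section Rectangle

variable {a b Θ : ℝ} {f g : ℝ × ℝ → ℝ} {q : ℝ × ℝ}

theorem uniqueDiffOn_closedRect (hab : a < b) (hΘ : 0 < Θ) :
    UniqueDiffOn ℝ (closedRect a b Θ) :=
  (uniqueDiffOn_Icc hab).prod (uniqueDiffOn_Icc hΘ)

theorem isOpen_openRect : IsOpen (openRect a b Θ) := isOpen_Ioo.prod isOpen_Ioo

theorem openRect_subset_closedRect : openRect a b Θ ⊆ closedRect a b Θ :=
  prod_mono Ioo_subset_Icc_self Ioo_subset_Icc_self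

theorem closedRect_mem_nhds (hq : q ∈ openRect a b Θ) : closedRect a b Θ ∈ nhds q :=
  Filter.mem_of_superset (isOpen_openRect.mem_nhds hq) openRect_subset_closedRect

theorem closure_openRect (hab : a < b) (hΘ : 0 < Θ) :
    closure (openRect a b Θ) = closedRect a b Θ := by
  rw [openRect, closure_prod_eq, closure_Ioo hab.ne, closure_Ioo hΘ.ne, closedRect]

/-- The equations hold only in the open sector; continuity of the one-sided derivatives carries them
to the edges, where the boundary data live. -/
theorem eqOn_closedRect_of_eqOn_openRect (hab : a < b) (hΘ : 0 < Θ)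
    (hf : ContinuousOn f (closedRect a b Θ)) (hg : ContinuousOn g (closedRect a b Θ))
    (h : ∀ q ∈ openRect a b Θ, f q = g q) : ∀ q ∈ closedRect a b Θ, f q = g q := by
  have h' : EqOn f g (openRect a b Θ) := h
  exact h'.of_subset_closure hf hg openRect_subset_closedRect (closure_openRect hab hΘ).ge

theorem contDiffOn_partialFst (hab : a < b) (hΘ : 0 < Θ) {n : ℕ∞}
    (hf : ContDiffOn ℝ (n + 1) f (closedRect a b Θ)) :
    ContDiffOn ℝ n (partialFst (closedRect a b Θ) f) (closedRect a b Θ) :=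
  (hf.fderivWithin (uniqueDiffOn_closedRect hab hΘ) le_rfl).clm_apply contDiffOn_const

theorem contDiffOn_partialSnd (hab : a < b) (hΘ : 0 < Θ) {n : ℕ∞}
    (hf : ContDiffOn ℝ (n + 1) f (closedRect a b Θ)) :
    ContDiffOn ℝ n (partialSnd (closedRect a b Θ) f) (closedRect a b Θ) :=
  (hf.fderivWithin (uniqueDiffOn_closedRect hab hΘ) le_rfl).clm_apply contDiffOn_const

theorem hasDerivWithinAt_fst (hf : DifferentiableOn ℝ f (closedRect a b Θ))
    (hq : q ∈ closedRect a b Θ) :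
    HasDerivWithinAt (fun s => f (s, q.2)) (partialFst (closedRect a b Θ) f q) (Icc a b) q.1 := by
  have h1 : HasDerivWithinAt (fun s : ℝ => (s, q.2)) ((1 : ℝ), (0 : ℝ)) (Icc a b) q.1 :=
    (hasDerivWithinAt_id _ _).prodMk (hasDerivWithinAt_const _ _ _)
  exact HasFDerivWithinAt.comp_hasDerivWithinAt (f := fun s : ℝ => (s, q.2)) q.1
    (hf q hq).hasFDerivWithinAt h1 (fun s hs => ⟨hs, hq.2⟩)

theorem hasDerivWithinAt_snd (hf : DifferentiableOn ℝ f (closedRect a b Θ))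
    (hq : q ∈ closedRect a b Θ) :
    HasDerivWithinAt (fun s => f (q.1, s)) (partialSnd (closedRect a b Θ) f q) (Icc 0 Θ) q.2 := by
  have h1 : HasDerivWithinAt (fun s : ℝ => (q.1, s)) ((0 : ℝ), (1 : ℝ)) (Icc 0 Θ) q.2 :=
    (hasDerivWithinAt_const _ _ _).prodMk (hasDerivWithinAt_id _ _)
  exact HasFDerivWithinAt.comp_hasDerivWithinAt (f := fun s : ℝ => (q.1, s)) q.2
    (hf q hq).hasFDerivWithinAt h1 (fun s hs => ⟨hq.1, hs⟩)

theorem hasFDerivAt_of_mem_openRect (hf : DifferentiableOn ℝ f (closedRect a b Θ))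
    (hq : q ∈ openRect a b Θ) :
    HasFDerivAt f (fderivWithin ℝ f (closedRect a b Θ) q) q :=
  (hf q (openRect_subset_closedRect hq)).hasFDerivWithinAt.hasFDerivAt (closedRect_mem_nhds hq)

theorem hasDerivAt_fst (hf : DifferentiableOn ℝ f (closedRect a b Θ))
    (hq : q ∈ openRect a b Θ) :
    HasDerivAt (fun s => f (s, q.2)) (partialFst (closedRect a b Θ) f q) q.1 :=
  (hasDerivWithinAt_fst hf (openRect_subset_closedRect hq)).hasDerivAt
    (Icc_mem_nhds hq.1.1 hq.1.2)

theorem hasDerivAt_snd (hf : DifferentiableOn ℝ f (closedRect a b Θ))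
    (hq : q ∈ openRect a b Θ) :
    HasDerivAt (fun s => f (q.1, s)) (partialSnd (closedRect a b Θ) f q) q.2 :=
  (hasDerivWithinAt_snd hf (openRect_subset_closedRect hq)).hasDerivAt
    (Icc_mem_nhds hq.2.1 hq.2.2)

theorem partialFst_partialSnd_comm (hab : a < b) (hΘ : 0 < Θ)
    (hf : ContDiffOn ℝ 2 f (closedRect a b Θ)) (hq : q ∈ openRect a b Θ) :
    partialFst (closedRect a b Θ) (partialSnd (closedRect a b Θ) f) q =
      partialSnd (closedRect a b Θ) (partialFst (closedRect a b Θ) f) q := by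
  set R := closedRect a b Θ
  have hU : UniqueDiffOn ℝ R := uniqueDiffOn_closedRect hab hΘ
  have hqR : q ∈ R := openRect_subset_closedRect hq
  have hD : DifferentiableWithinAt ℝ (fderivWithin ℝ f R) R q :=
    ((hf.fderivWithin hU (m := 1) le_rfl).differentiableOn one_ne_zero) q hqR
  have key : ∀ v w : ℝ × ℝ, fderivWithin ℝ (fun p => fderivWithin ℝ f R p v) R q w =
      fderivWithin ℝ (fderivWithin ℝ f R) R q w v := by
    intro v w
    rw [fderivWithin_clm_apply (hU q hqR) hD (differentiableWithinAt_const v)]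
    simp
  have hsymm := second_derivative_symmetric_of_eventually (𝕜 := ℝ)
    (f := f) (f' := fderivWithin ℝ f R) (x := q)
    (Filter.eventually_of_mem (isOpen_openRect.mem_nhds hq)
      fun y hy => hasFDerivAt_of_mem_openRect (hf.differentiableOn two_ne_zero) hy)
    (hD.hasFDerivWithinAt.hasFDerivAt (closedRect_mem_nhds hq)) (1, 0) (0, 1)
  unfold partialFst partialSnd
  rw [key, key, hsymm]

theorem integral_divergence_closedRect (hab : a < b) (hΘ : 0 < Θ)
    (hf : ContDiffOn ℝ 1 f (closedRect a b Θ)) (hg : ContDiffOn ℝ 1 g (closedRect a b Θ)) :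
    (∫ q in closedRect a b Θ,
        partialFst (closedRect a b Θ) f q + partialSnd (closedRect a b Θ) g q) =
      (((∫ t in a..b, g (t, Θ)) - ∫ t in a..b, g (t, 0)) + ∫ y in (0 : ℝ)..Θ, f (b, y)) -
        ∫ y in (0 : ℝ)..Θ, f (a, y) := by
  have hI : closedRect a b Θ = Icc (a, 0) (b, Θ) := by
    rw [closedRect, Icc_prod_Icc]
  have hcont : ContinuousOn (fun q => partialFst (closedRect a b Θ) f q +
      partialSnd (closedRect a b Θ) g q) (closedRect a b Θ) :=
    (contDiffOn_partialFst (n := 0) hab hΘ (by simpa using hf)).continuousOn.add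
      (contDiffOn_partialSnd (n := 0) hab hΘ (by simpa using hg)).continuousOn
  have hint : MeasureTheory.IntegrableOn (fun q => partialFst (closedRect a b Θ) f q +
      partialSnd (closedRect a b Θ) g q) (closedRect a b Θ) :=
    hcont.integrableOn_compact (isCompact_Icc.prod isCompact_Icc)
  have hf' := hf.differentiableOn one_ne_zero
  have hg' := hg.differentiableOn one_ne_zero
  have := MeasureTheory.integral_divergence_prod_Icc_of_hasFDerivAt_of_le f g
    (fderivWithin ℝ f (closedRect a b Θ)) (fderivWithin ℝ g (closedRect a b Θ))
    (a, 0) (b, Θ) ⟨hab.le, hΘ.le⟩ (hI ▸ hf.continuousOn) (hI ▸ hg.continuousOn)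
    (fun x hx => hasFDerivAt_of_mem_openRect hf' hx)
    (fun x hx => hasFDerivAt_of_mem_openRect hg' hx) (hI ▸ hint)
  rw [← hI] at this
  exact this

/-- If the boundary fluxes of a `C¹` field on a rectangle cancel and its divergence is nonnegative,
then its divergence vanishes. -/
theorem divergence_eq_zero_of_nonneg (hab : a < b) (hΘ : 0 < Θ)
    (hf : ContDiffOn ℝ 1 f (closedRect a b Θ)) (hg : ContDiffOn ℝ 1 g (closedRect a b Θ))
    (hfper : ∀ y ∈ Icc 0 Θ, f (b, y) = f (a, y)) (hgper : ∀ t ∈ Icc a b, g (t, Θ) = g (t, 0))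
    {Q : ℝ × ℝ → ℝ} (hQ : ∀ q ∈ openRect a b Θ, 0 ≤ Q q)
    (hdiv : ∀ q ∈ openRect a b Θ, ∃ x y, HasDerivAt (fun s => f (s, q.2)) x q.1 ∧
      HasDerivAt (fun s => g (q.1, s)) y q.2 ∧ x + y = Q q) :
    ∀ q ∈ openRect a b Θ, Q q = 0 := by
  set R := closedRect a b Θ
  set D : ℝ × ℝ → ℝ := fun q => partialFst R f q + partialSnd R g q
  have hDQ : ∀ q ∈ openRect a b Θ, D q = Q q := by
    intro q hq
    obtain ⟨x, y, hx, hy, hxy⟩ := hdiv q hq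
    have h1 := (hasDerivAt_fst (hf.differentiableOn one_ne_zero) hq).unique hx
    have h2 := (hasDerivAt_snd (hg.differentiableOn one_ne_zero) hq).unique hy
    rw [← hxy, ← h1, ← h2]
  have hcont : ContinuousOn D R :=
    (contDiffOn_partialFst (n := 0) hab hΘ (by simpa using hf)).continuousOn.add
      (contDiffOn_partialSnd (n := 0) hab hΘ (by simpa using hg)).continuousOn
  have hint : MeasureTheory.IntegrableOn D R :=
    hcont.integrableOn_compact (isCompact_Icc.prod isCompact_Icc)
  have hzero : ∫ q in R, D q = 0 := by
    rw [integral_divergence_closedRect hab hΘ hf hg]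
    have h1 : ∫ t in a..b, g (t, Θ) = ∫ t in a..b, g (t, 0) :=
      intervalIntegral.integral_congr fun t ht => hgper t (by rwa [uIcc_of_le hab.le] at ht)
    have h2 : ∫ y in (0 : ℝ)..Θ, f (b, y) = ∫ y in (0 : ℝ)..Θ, f (a, y) :=
      intervalIntegral.integral_congr fun t ht => hfper t (by rwa [uIcc_of_le hΘ.le] at ht)
    rw [h1, h2]; ring
  have hint' : MeasureTheory.IntegrableOn D (openRect a b Θ) :=
    hint.mono_set openRect_subset_closedRect
  -- The sign passes to the edges by continuity. A nonnegative function with zero integral vanishes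
  -- almost everywhere, and a continuous one then vanishes at every point of the open rectangle.
  have hDR : ∀ q ∈ R, 0 ≤ D q := by
    intro q hq
    have hq' : q ∈ closure (openRect a b Θ) := by rwa [closure_openRect hab hΘ]
    refine ContinuousWithinAt.closure_le (f := fun _ => (0 : ℝ)) hq' continuousWithinAt_const
      ((hcont q hq).mono openRect_subset_closedRect) fun y hy => ?_
    rw [hDQ y hy]; exact hQ y hy
  have hae : D =ᵐ[MeasureTheory.volume.restrict R] 0 := by
    rwa [MeasureTheory.setIntegral_eq_zero_iff_of_nonneg_ae _ hint] at hzero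
    exact (MeasureTheory.ae_restrict_iff' (measurableSet_Icc.prod measurableSet_Icc)).2
      (Filter.Eventually.of_forall hDR)
  have hae' : D =ᵐ[MeasureTheory.volume.restrict (openRect a b Θ)] fun _ => (0 : ℝ) :=
    MeasureTheory.ae_restrict_of_ae_restrict_of_subset openRect_subset_closedRect hae
  have := MeasureTheory.Measure.eqOn_open_of_ae_eq hae' isOpen_openRect
    (hcont.mono openRect_subset_closedRect) continuousOn_const
  intro q hq
  rw [← hDQ q hq]; exact this hq

theorem eq_of_partialSnd_eq_zero_on_line (hΘ : 0 < Θ)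
    (hf : DifferentiableOn ℝ f (closedRect a b Θ)) {x y z : ℝ} (hx : x ∈ Icc a b)
    (h : ∀ s ∈ Icc 0 Θ, partialSnd (closedRect a b Θ) f (x, s) = 0)
    (hy : y ∈ Icc 0 Θ) (hz : z ∈ Icc 0 Θ) : f (x, y) = f (x, z) :=
  (convex_Icc (0 : ℝ) Θ).is_const_of_fderivWithin_eq_zero (𝕜 := ℝ) (f := fun s => f (x, s))
    (fun s hs => (hasDerivWithinAt_snd hf (q := (x, s)) ⟨hx, hs⟩).differentiableWithinAt)
    (fun s hs => by
      have h1 := hasDerivWithinAt_snd hf (q := (x, s)) ⟨hx, hs⟩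
      rw [h s hs] at h1
      rw [h1.hasFDerivWithinAt.fderivWithin (uniqueDiffOn_Icc hΘ s hs)]
      ext; simp) hy hz

theorem eq_of_partialFst_eq_zero_on_line (hab : a < b)
    (hf : DifferentiableOn ℝ f (closedRect a b Θ)) {x y z : ℝ} (hy : y ∈ Icc 0 Θ)
    (h : ∀ s ∈ Icc a b, partialFst (closedRect a b Θ) f (s, y) = 0)
    (hx : x ∈ Icc a b) (hz : z ∈ Icc a b) : f (x, y) = f (z, y) :=
  (convex_Icc a b).is_const_of_fderivWithin_eq_zero (𝕜 := ℝ) (f := fun s => f (s, y))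
    (fun s hs => (hasDerivWithinAt_fst hf (q := (s, y)) ⟨hs, hy⟩).differentiableWithinAt)
    (fun s hs => by
      have h1 := hasDerivWithinAt_fst hf (q := (s, y)) ⟨hs, hy⟩
      rw [h s hs] at h1
      rw [h1.hasFDerivWithinAt.fderivWithin (uniqueDiffOn_Icc hab s hs)]
      ext; simp) hx hz

theorem eq_of_partialSnd_eq_zero (hab : a < b) (hΘ : 0 < Θ)
    (hf : ContDiffOn ℝ 1 f (closedRect a b Θ))
    (h : ∀ q ∈ openRect a b Θ, partialSnd (closedRect a b Θ) f q = 0)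
    {x y z : ℝ} (hx : x ∈ Icc a b) (hy : y ∈ Icc 0 Θ) (hz : z ∈ Icc 0 Θ) : f (x, y) = f (x, z) :=
  eq_of_partialSnd_eq_zero_on_line hΘ (hf.differentiableOn one_ne_zero) hx
    (fun _ hs => eqOn_closedRect_of_eqOn_openRect hab hΘ
      (contDiffOn_partialSnd (n := 0) hab hΘ (by simpa using hf)).continuousOn
      continuousOn_const h _ ⟨hx, hs⟩) hy hz

theorem eq_of_partialFst_eq_zero (hab : a < b) (hΘ : 0 < Θ)
    (hf : ContDiffOn ℝ 1 f (closedRect a b Θ))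
    (h : ∀ q ∈ openRect a b Θ, partialFst (closedRect a b Θ) f q = 0)
    {x y z : ℝ} (hy : y ∈ Icc 0 Θ) (hx : x ∈ Icc a b) (hz : z ∈ Icc a b) : f (x, y) = f (z, y) :=
  eq_of_partialFst_eq_zero_on_line hab (hf.differentiableOn one_ne_zero) hy
    (fun _ hs => eqOn_closedRect_of_eqOn_openRect hab hΘ
      (contDiffOn_partialFst (n := 0) hab hΘ (by simpa using hf)).continuousOn
      continuousOn_const h _ ⟨hs, hy⟩) hx hz

/-- A closed `C¹` one-form on a rectangle has a potential. -/
theorem exists_potential_closedRect (hab : a < b) (hΘ : 0 < Θ)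
    (hf : ContDiffOn ℝ 1 f (closedRect a b Θ)) (hg : ContDiffOn ℝ 1 g (closedRect a b Θ))
    (h : ∀ q ∈ openRect a b Θ,
      partialSnd (closedRect a b Θ) f q = partialFst (closedRect a b Θ) g q) :
    ∃ ψ : ℝ × ℝ → ℝ, ContDiffOn ℝ 1 ψ (closedRect a b Θ) ∧
      (∀ q ∈ closedRect a b Θ, partialFst (closedRect a b Θ) ψ q = f q) ∧
      ∀ q ∈ closedRect a b Θ, partialSnd (closedRect a b Θ) ψ q = g q := by
  set R := closedRect a b Θ
  have hU : UniqueDiffOn ℝ R := uniqueDiffOn_closedRect hab hΘ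
  -- The Poincaré lemma on a convex set needs closedness of the form at boundary points too.
  have hcl := eqOn_closedRect_of_eqOn_openRect hab hΘ
    (contDiffOn_partialSnd (n := 0) hab hΘ (by simpa using hf)).continuousOn
    (contDiffOn_partialFst (n := 0) hab hΘ (by simpa using hg)).continuousOn h
  set ω : ℝ × ℝ → ℝ × ℝ →L[ℝ] ℝ := fun q =>
    f q • ContinuousLinearMap.fst ℝ ℝ ℝ + g q • ContinuousLinearMap.snd ℝ ℝ ℝ
  have hω : ContDiffOn ℝ 1 ω R := (hf.smul contDiffOn_const).add (hg.smul contDiffOn_const)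
  have hfd := hf.differentiableOn one_ne_zero
  have hgd := hg.differentiableOn one_ne_zero
  have hdec : ∀ (L : ℝ × ℝ →L[ℝ] ℝ) (x : ℝ × ℝ), L x = x.1 * L (1, 0) + x.2 * L (0, 1) := by
    intro L x
    have : x = x.1 • ((1 : ℝ), (0 : ℝ)) + x.2 • ((0 : ℝ), (1 : ℝ)) := by ext <;> simp
    conv_lhs => rw [this]
    rw [map_add, map_smul, map_smul, smul_eq_mul, smul_eq_mul]
  obtain ⟨ψ, hψ⟩ := Convex.exists_forall_hasFDerivWithinAt_of_hasFDerivWithinAt_symmetric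
    (s := R) (ω := ω) ((convex_Icc a b).prod (convex_Icc 0 Θ))
    (fun q hq => ((hfd q hq).hasFDerivWithinAt.smul_const (ContinuousLinearMap.fst ℝ ℝ ℝ)).add
      ((hgd q hq).hasFDerivWithinAt.smul_const (ContinuousLinearMap.snd ℝ ℝ ℝ)))
    (by
      intro q hq x _ y _
      have := hcl q hq
      unfold partialFst partialSnd at this
      simp only [add_apply, ContinuousLinearMap.smulRight_apply,
        smul_apply, smul_eq_mul, ContinuousLinearMap.coe_fst',
        ContinuousLinearMap.coe_snd']
      rw [hdec _ x, hdec _ y, hdec (fderivWithin ℝ g R q) x, hdec (fderivWithin ℝ g R q) y, this]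
      ring)
  have hfw : ∀ q ∈ R, fderivWithin ℝ ψ R q = ω q := fun q hq => (hψ q hq).fderivWithin (hU q hq)
  refine ⟨ψ, ?_, ?_, ?_⟩
  · have h0 : ContDiffOn ℝ (0 + 1) ψ R := by
      rw [contDiffOn_succ_iff_fderivWithin hU]
      refine ⟨fun q hq => (hψ q hq).differentiableWithinAt, by simp, ?_⟩
      exact (hω.of_le zero_le_one).congr hfw
    simpa using h0
  · intro q hq
    simp [partialFst, hfw q hq, ω]
  · intro q hq
    simp [partialSnd, hfw q hq, ω]

end Rectangle

/-! ### Partial derivatives along lines, and constancy of sign. -/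

section Rectangle

variable {a b Θ : ℝ} {f g : ℝ × ℝ → ℝ} {q : ℝ × ℝ}

theorem partialFst_eq_of_hasDerivAt (hf : DifferentiableOn ℝ f (closedRect a b Θ))
    (hq : q ∈ openRect a b Θ) {x : ℝ} (h : HasDerivAt (fun s => f (s, q.2)) x q.1) :
    partialFst (closedRect a b Θ) f q = x :=
  (hasDerivAt_fst hf hq).unique h

theorem partialSnd_eq_of_hasDerivAt (hf : DifferentiableOn ℝ f (closedRect a b Θ))
    (hq : q ∈ openRect a b Θ) {x : ℝ} (h : HasDerivAt (fun s => f (q.1, s)) x q.2) :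
    partialSnd (closedRect a b Θ) f q = x :=
  (hasDerivAt_snd hf hq).unique h

theorem partialFst_congr {S : Set (ℝ × ℝ)} (h : ∀ p ∈ S, f p = g p) (hq : q ∈ S) :
    partialFst S f q = partialFst S g q := by
  unfold partialFst
  rw [fderivWithin_congr h (h q hq)]

theorem partialSnd_congr {S : Set (ℝ × ℝ)} (h : ∀ p ∈ S, f p = g p) (hq : q ∈ S) :
    partialSnd S f q = partialSnd S g q := by
  unfold partialSnd
  rw [fderivWithin_congr h (h q hq)]

/-- If two functions on a rectangle agree along two vertical lines, so do their derivatives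
along these lines. -/
theorem partialSnd_eq_of_eq_on_lines (hΘ : 0 < Θ) (hf : DifferentiableOn ℝ f (closedRect a b Θ))
    {x x' y : ℝ} (hx : x ∈ Icc a b) (hx' : x' ∈ Icc a b) (hy : y ∈ Icc 0 Θ)
    (h : ∀ s ∈ Icc 0 Θ, f (x, s) = f (x', s)) :
    partialSnd (closedRect a b Θ) f (x, y) = partialSnd (closedRect a b Θ) f (x', y) := by
  have h1 := hasDerivWithinAt_snd hf (q := (x, y)) ⟨hx, hy⟩
  have h2 := hasDerivWithinAt_snd hf (q := (x', y)) ⟨hx', hy⟩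
  exact (uniqueDiffOn_Icc hΘ y hy).eq_deriv _ h1 (h2.congr h (h y hy))

theorem partialFst_eq_zero_of_const_on_line (hab : a < b)
    (hf : DifferentiableOn ℝ f (closedRect a b Θ)) {x y c : ℝ} (hx : x ∈ Icc a b)
    (hy : y ∈ Icc 0 Θ) (h : ∀ s ∈ Icc a b, f (s, y) = c) :
    partialFst (closedRect a b Θ) f (x, y) = 0 := by
  have h1 := hasDerivWithinAt_fst hf (q := (x, y)) ⟨hx, hy⟩
  exact (uniqueDiffOn_Icc hab x hx).eq_deriv _ h1
    ((hasDerivWithinAt_const x (Icc a b) c).congr h (h x hx))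

theorem pos_or_neg_of_ne_zero {X : Type*} [TopologicalSpace X] {S : Set X} {f : X → ℝ}
    (hS : IsPreconnected S) (hf : ContinuousOn f S) (h : ∀ x ∈ S, f x ≠ 0) :
    (∀ x ∈ S, 0 < f x) ∨ ∀ x ∈ S, f x < 0 := by
  by_contra! hcon
  obtain ⟨⟨x, hx, hx0⟩, y, hy, hy0⟩ := hcon
  obtain ⟨z, hz, hz0⟩ := hS.intermediate_value hx hy hf ⟨hx0, hy0⟩
  exact h z hz hz0

theorem isPreconnected_closedRect : IsPreconnected (closedRect a b Θ) :=
  isPreconnected_Icc.prod isPreconnected_Icc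

end Rectangle

/-! ### Periodic solutions of the vorticity equation in the coordinates `(log r, θ)` -/

section Flow

variable {T Θ : ℝ} {v w : ℝ × ℝ → ℝ}

/-- Minus the vorticity times `r²`, in the coordinates `(log r, θ)`. -/
noncomputable def scaledVorticity (S : Set (ℝ × ℝ)) (v w : ℝ × ℝ → ℝ) (q : ℝ × ℝ) : ℝ :=
  partialFst S v q - partialSnd S w q

theorem contDiffOn_scaledVorticity (hT : 0 < T) (hΘ : 0 < Θ)
    (hv : ContDiffOn ℝ 2 v (closedRect 0 T Θ)) (hw : ContDiffOn ℝ 2 w (closedRect 0 T Θ)) :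
    ContDiffOn ℝ 1 (scaledVorticity (closedRect 0 T Θ) v w) (closedRect 0 T Θ) :=
  (contDiffOn_partialFst (n := 1) hT hΘ hv).sub (contDiffOn_partialSnd (n := 1) hT hΘ hw)

/-- The energy identity for the quotient `v / w`. -/
theorem eq_zero_of_energy_identity (hT : 0 < T) (hΘ : 0 < Θ)
    (hv : ContDiffOn ℝ 2 v (closedRect 0 T Θ)) (hw : ContDiffOn ℝ 2 w (closedRect 0 T Θ))
    (hne : ∀ q ∈ closedRect 0 T Θ, w q ≠ 0)
    (hdiv : ∀ q ∈ openRect 0 T Θ,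
      partialFst (closedRect 0 T Θ) w q + partialSnd (closedRect 0 T Θ) v q = 0)
    (α : ℝ)
    (hvort : ∀ q ∈ openRect 0 T Θ,
      w q * partialFst (closedRect 0 T Θ) (scaledVorticity (closedRect 0 T Θ) v w) q +
        v q * partialSnd (closedRect 0 T Θ) (scaledVorticity (closedRect 0 T Θ) v w) q =
          2 * α * w q * scaledVorticity (closedRect 0 T Θ) v w q)
    (hbot : ∀ t ∈ Icc 0 T, v (t, 0) = 0) (htop : ∀ t ∈ Icc 0 T, v (t, Θ) = 0)
    (hperv : ∀ y ∈ Icc 0 Θ, v (T, y) = v (0, y)) (hperw : ∀ y ∈ Icc 0 Θ, w (T, y) = w (0, y))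
    (hperd : ∀ y ∈ Icc 0 Θ,
      partialFst (closedRect 0 T Θ) v (T, y) = partialFst (closedRect 0 T Θ) v (0, y)) :
    ∀ q ∈ closedRect 0 T Θ, v q = 0 := by
  set R := closedRect 0 T Θ
  have hvd := hv.differentiableOn two_ne_zero
  have hwd := hw.differentiableOn two_ne_zero
  have hv1 : ContDiffOn ℝ 1 v R := hv.of_le one_le_two
  have hw1 : ContDiffOn ℝ 1 w R := hw.of_le one_le_two
  have hvt : ContDiffOn ℝ 1 (partialFst R v) R := contDiffOn_partialFst (n := 1) hT hΘ hv
  have hwt : ContDiffOn ℝ 1 (partialFst R w) R := contDiffOn_partialFst (n := 1) hT hΘ hw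
  have hvθ : ContDiffOn ℝ 1 (partialSnd R v) R := contDiffOn_partialSnd (n := 1) hT hΘ hv
  have hwθ : ContDiffOn ℝ 1 (partialSnd R w) R := contDiffOn_partialSnd (n := 1) hT hΘ hw
  have hdivR : ∀ q ∈ R, partialFst R w q + partialSnd R v q = 0 :=
    eqOn_closedRect_of_eqOn_openRect hT hΘ (hwt.add hvθ).continuousOn continuousOn_const hdiv
  have h0T : (0 : ℝ) ∈ Icc 0 T := ⟨le_rfl, hT.le⟩
  have hTT : T ∈ Icc 0 T := ⟨hT.le, le_rfl⟩
  -- Periodicity of w_t is not assumed: w_t = -v_θ, and v_θ inherits periodicity from v.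
  have hperwt : ∀ y ∈ Icc 0 Θ, partialFst R w (T, y) = partialFst R w (0, y) := by
    intro y hy
    have h1 := hdivR (T, y) ⟨hTT, hy⟩
    have h2 := hdivR (0, y) ⟨h0T, hy⟩
    have h3 := partialSnd_eq_of_eq_on_lines hΘ hvd hTT h0T hy hperv
    linarith
  have hφ : ContDiffOn ℝ 1 (fun q => v q / w q) R := hv1.div hw1 hne
  -- With φ = v/w, the field is φ w²∇φ + α (w² - v², 2vw) and its divergence is w²|∇φ|². The second
  -- summand has divergence -2αvζ, which cancels φ div(w²∇φ) = 2αvζ.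
  have hzero := divergence_eq_zero_of_nonneg hT hΘ
    (f := fun q => v q / w q * (w q * partialFst R v q - v q * partialFst R w q) +
      α * (w q ^ 2 - v q ^ 2))
    (g := fun q => v q / w q * (w q * partialSnd R v q - v q * partialSnd R w q) +
      α * (2 * (v q * w q)))
    (Q := fun q => ((w q * partialFst R v q - v q * partialFst R w q) ^ 2 +
      (w q * partialSnd R v q - v q * partialSnd R w q) ^ 2) / w q ^ 2)
    ((hφ.mul ((hw1.mul hvt).sub (hv1.mul hwt))).add
      (contDiffOn_const.mul ((hw1.pow 2).sub (hv1.pow 2))))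
    ((hφ.mul ((hw1.mul hvθ).sub (hv1.mul hwθ))).add
      (contDiffOn_const.mul (contDiffOn_const.mul (hv1.mul hw1))))
    (fun y hy => by simp only [hperv y hy, hperw y hy, hperd y hy, hperwt y hy])
    (fun t ht => by simp only [hbot t ht, htop t ht]; ring)
    (fun q _ => by positivity)
    (by
      intro q hq
      have hqR : q ∈ R := openRect_subset_closedRect hq
      have d1v := hasDerivAt_fst hvd hq
      have d2v := hasDerivAt_snd hvd hq
      have d1w := hasDerivAt_fst hwd hq
      have d2w := hasDerivAt_snd hwd hq
      have d1vt := hasDerivAt_fst (hvt.differentiableOn one_ne_zero) hq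
      have d1wt := hasDerivAt_fst (hwt.differentiableOn one_ne_zero) hq
      have d2vθ := hasDerivAt_snd (hvθ.differentiableOn one_ne_zero) hq
      have d2wθ := hasDerivAt_snd (hwθ.differentiableOn one_ne_zero) hq
      have d2vt := hasDerivAt_snd (hvt.differentiableOn one_ne_zero) hq
      have d1wθ := hasDerivAt_fst (hwθ.differentiableOn one_ne_zero) hq
      have d2wt := hasDerivAt_snd (hwt.differentiableOn one_ne_zero) hq
      have cv := partialFst_partialSnd_comm hT hΘ hv hq
      have cw := partialFst_partialSnd_comm hT hΘ hw hq
      have hζ := (contDiffOn_scaledVorticity hT hΘ hv hw).differentiableOn one_ne_zero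
      have e1 := partialFst_eq_of_hasDerivAt hζ hq (d1vt.sub d1wθ)
      have e2 := partialSnd_eq_of_hasDerivAt hζ hq (d2vt.sub d2wθ)
      -- Differentiating w_t + v_θ = 0 turns Δv into ζ_t and Δw into -ζ_θ.
      have e3 : partialFst R (partialSnd R v) q = -partialFst R (partialFst R w) q :=
        (partialFst_congr (g := fun q => -partialFst R w q)
          (fun p hp => by linarith [hdivR p hp]) hqR).trans
        (partialFst_eq_of_hasDerivAt (hwt.differentiableOn one_ne_zero).neg hq d1wt.neg)
      have e4 : partialSnd R (partialSnd R v) q = -partialSnd R (partialFst R w) q :=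
        (partialSnd_congr (g := fun q => -partialFst R w q)
          (fun p hp => by linarith [hdivR p hp]) hqR).trans
        (partialSnd_eq_of_hasDerivAt (hwt.differentiableOn one_ne_zero).neg hq d2wt.neg)
      have e5 := hdivR q hqR
      have e6 := hvort q hq
      have hwq := hne q hqR
      refine ⟨_, _, ((d1v.div d1w hwq).mul ((d1w.mul d1vt).sub (d1v.mul d1wt))).add
        (((d1w.pow 2).sub (d1v.pow 2)).const_mul α),
        ((d2v.div d2w hwq).mul ((d2w.mul d2vθ).sub (d2v.mul d2wθ))).add
        (((d2v.mul d2w).const_mul 2).const_mul α), ?_⟩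
      rw [e1, e2] at e6
      simp only [scaledVorticity] at e6
      simp only [Pi.sub_apply, Pi.mul_apply, Pi.div_apply, Prod.mk.eta]
      have e7 : partialFst R (partialFst R w) q = -partialSnd R (partialFst R v) q := by
        linarith
      have e8 : partialSnd R (partialFst R w) q = partialFst R (partialSnd R w) q := cw.symm
      have e9 : partialFst R w q = - partialSnd R v q := by linarith
      rw [e7, e4, e8, e9]
      field_simp
      push_cast
      linear_combination (v q * w q) * e6)
  have hφz : ∀ q ∈ openRect 0 T Θ, partialSnd R (fun q => v q / w q) q = 0 := by
    intro q hq
    have hwq := hne q (openRect_subset_closedRect hq)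
    rw [partialSnd_eq_of_hasDerivAt (hφ.differentiableOn one_ne_zero) hq
      ((hasDerivAt_snd hvd hq).div (hasDerivAt_snd hwd hq) hwq)]
    have h1 := hzero q hq
    simp only [div_eq_zero_iff, pow_eq_zero_iff two_ne_zero, hwq, or_false] at h1
    have h2 : w q * partialSnd R v q - v q * partialSnd R w q = 0 := by
      nlinarith [sq_nonneg (w q * partialFst R v q - v q * partialFst R w q),
        sq_nonneg (w q * partialSnd R v q - v q * partialSnd R w q)]
    simp only [Prod.mk.eta]
    rw [show partialSnd R v q * w q - v q * partialSnd R w q = 0 by linarith, zero_div]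
  intro q hq
  have h1 := eq_of_partialSnd_eq_zero hT hΘ hφ hφz hq.1 hq.2 ⟨le_rfl, hΘ.le⟩
  simp only [hbot q.1 hq.1, zero_div, Prod.mk.eta, div_eq_zero_iff, hne q hq, or_false] at h1
  exact h1

/-- A quantity transported by the flow `(w, v)` which is constant along the inflow or the outflow
edge is constant. Here `ψ` is the periodic part of the stream function. -/
theorem eq_const_of_transport (hT : 0 < T) (hΘ : 0 < Θ)
    (hv : ContDiffOn ℝ 1 v (closedRect 0 T Θ)) (hw : ContDiffOn ℝ 1 w (closedRect 0 T Θ))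
    (hne : ∀ q ∈ closedRect 0 T Θ, w q ≠ 0)
    (hdiv : ∀ q ∈ openRect 0 T Θ,
      partialFst (closedRect 0 T Θ) w q + partialSnd (closedRect 0 T Θ) v q = 0)
    (hperw : ∀ y ∈ Icc 0 Θ, w (T, y) = w (0, y))
    {ψ h : ℝ × ℝ → ℝ} {c A κ : ℝ} (hc : c ≠ 0)
    (hψ : ContDiffOn ℝ 1 ψ (closedRect 0 T Θ)) (hh : ContDiffOn ℝ 1 h (closedRect 0 T Θ))
    (hψt : ∀ q ∈ closedRect 0 T Θ, partialFst (closedRect 0 T Θ) ψ q = c - v q)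
    (hψθ : ∀ q ∈ closedRect 0 T Θ, partialSnd (closedRect 0 T Θ) ψ q = w q)
    (htr : ∀ q ∈ openRect 0 T Θ, w q * partialFst (closedRect 0 T Θ) h q +
      v q * partialSnd (closedRect 0 T Θ) h q = 0)
    (hperψ : ∀ y ∈ Icc 0 Θ, ψ (T, y) = ψ (0, y)) (hperh : ∀ y ∈ Icc 0 Θ, h (T, y) = h (0, y))
    (hbot : ∀ t ∈ Icc 0 T, (h (t, 0) - A) * (ψ (t, 0) - κ) = 0)
    (htop : ∀ t ∈ Icc 0 T, (h (t, Θ) - A) * (ψ (t, Θ) - κ) = 0) :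
    ∀ q ∈ closedRect 0 T Θ, h q = A := by
  set R := closedRect 0 T Θ
  -- The constant s is the sign of w, needed only to make the divergence below nonnegative.
  obtain ⟨s, hs⟩ : ∃ s : ℝ, ∀ q ∈ R, 0 < s * w q := by
    rcases pos_or_neg_of_ne_zero isPreconnected_closedRect hw.continuousOn hne with h1 | h1
    · exact ⟨1, fun q hq => by simpa using h1 q hq⟩
    · exact ⟨-1, fun q hq => by simpa using h1 q hq⟩
  have hk : ContDiffOn ℝ 1 (fun q => s * c * ((h q - A) ^ 2 * (ψ q - κ))) R :=
    contDiffOn_const.mul (((hh.sub contDiffOn_const).pow 2).mul (hψ.sub contDiffOn_const))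
  have hedge : ∀ x y z : ℝ, x * y = 0 → z * (s * c * (x ^ 2 * y)) = 0 := by
    intro x y z hxy
    linear_combination z * s * c * x * hxy
  -- The flow derivative of ψ is w(c - v) + vw = cw, and h is transported. So the flux of s c (h -
  -- A)² (ψ - κ) along (w, v) has divergence s w c² (h - A)². On each edge one of the factors h - A,
  -- ψ - κ vanishes.
  have hzero := divergence_eq_zero_of_nonneg hT hΘ
    (f := fun q => w q * (s * c * ((h q - A) ^ 2 * (ψ q - κ))))
    (g := fun q => v q * (s * c * ((h q - A) ^ 2 * (ψ q - κ))))
    (Q := fun q => s * w q * (c * (h q - A)) ^ 2)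
    (hw.mul hk) (hv.mul hk)
    (fun y hy => by simp only [hperψ y hy, hperw y hy, hperh y hy])
    (fun t ht => (hedge _ _ _ (htop t ht)).trans (hedge _ _ _ (hbot t ht)).symm)
    (fun q hq => mul_nonneg (hs q (openRect_subset_closedRect hq)).le (sq_nonneg _))
    (by
      intro q hq
      have hqR : q ∈ R := openRect_subset_closedRect hq
      have d1v := hasDerivAt_snd (hv.differentiableOn one_ne_zero) hq
      have d1w := hasDerivAt_fst (hw.differentiableOn one_ne_zero) hq
      have d1h := hasDerivAt_fst (hh.differentiableOn one_ne_zero) hq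
      have d2h := hasDerivAt_snd (hh.differentiableOn one_ne_zero) hq
      have d1ψ := hasDerivAt_fst (hψ.differentiableOn one_ne_zero) hq
      have d2ψ := hasDerivAt_snd (hψ.differentiableOn one_ne_zero) hq
      refine ⟨_, _, d1w.mul ((((d1h.sub_const A).pow 2).mul (d1ψ.sub_const κ)).const_mul (s * c)),
        d1v.mul ((((d2h.sub_const A).pow 2).mul (d2ψ.sub_const κ)).const_mul (s * c)), ?_⟩
      simp only [Pi.pow_apply, Prod.mk.eta]
      rw [hψt q hqR, hψθ q hqR]
      push_cast
      linear_combination (s * c * ((h q - A) ^ 2 * (ψ q - κ))) * hdiv q hq +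
        (2 * s * c * (h q - A) * (ψ q - κ)) * htr q hq)
  refine eqOn_closedRect_of_eqOn_openRect hT hΘ hh.continuousOn continuousOn_const ?_
  intro q hq
  have h1 := hzero q hq
  have h2 := (hs q (openRect_subset_closedRect hq)).ne'
  simp only [mul_eq_zero, h2, pow_eq_zero_iff two_ne_zero, hc, false_or] at h1
  have h3 : h q - A = 0 := by simpa [← mul_eq_zero, h2] using h1
  linarith

end Flow

/-! ### Rigidity of periodic flows with constant edge values. -/

section Flow

variable {T Θ c₁ c₂ : ℝ} {v w : ℝ × ℝ → ℝ}

/-- A divergence-free field `(w, v)` with the vorticity equation, periodic in the first variable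
and with constant values of `v` along the two edges. -/
structure IsPeriodicFlow (T Θ c₁ c₂ : ℝ) (v w : ℝ × ℝ → ℝ) : Prop where
  contDiffOn_v : ContDiffOn ℝ 2 v (closedRect 0 T Θ)
  contDiffOn_w : ContDiffOn ℝ 2 w (closedRect 0 T Θ)
  ne_zero : ∀ q ∈ closedRect 0 T Θ, w q ≠ 0
  div_eq_zero : ∀ q ∈ openRect 0 T Θ,
    partialFst (closedRect 0 T Θ) w q + partialSnd (closedRect 0 T Θ) v q = 0
  vorticity : ∀ q ∈ openRect 0 T Θ,
    w q * partialFst (closedRect 0 T Θ) (scaledVorticity (closedRect 0 T Θ) v w) q +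
      v q * partialSnd (closedRect 0 T Θ) (scaledVorticity (closedRect 0 T Θ) v w) q =
        2 * w q * scaledVorticity (closedRect 0 T Θ) v w q
  bot : ∀ t ∈ Icc 0 T, v (t, 0) = c₁
  top : ∀ t ∈ Icc 0 T, v (t, Θ) = c₂
  periodic_v : ∀ y ∈ Icc 0 Θ, v (T, y) = v (0, y)
  periodic_w : ∀ y ∈ Icc 0 Θ, w (T, y) = w (0, y)
  periodic_deriv : ∀ y ∈ Icc 0 Θ,
    partialFst (closedRect 0 T Θ) v (T, y) = partialFst (closedRect 0 T Θ) v (0, y)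

namespace IsPeriodicFlow

/-- By the divergence theorem the total flux is zero; the fluxes through t = 0 and t = T cancel by
periodicity, leaving T(c₂ - c₁) = 0. -/
theorem edge_values_eq (hT : 0 < T) (hΘ : 0 < Θ) (H : IsPeriodicFlow T Θ c₁ c₂ v w) : c₁ = c₂ := by
  have h := integral_divergence_closedRect hT hΘ (H.contDiffOn_w.of_le one_le_two)
    (H.contDiffOn_v.of_le one_le_two)
  have hz : ∀ q ∈ closedRect 0 T Θ,
      partialFst (closedRect 0 T Θ) w q + partialSnd (closedRect 0 T Θ) v q = 0 :=
    eqOn_closedRect_of_eqOn_openRect hT hΘ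
      ((contDiffOn_partialFst (n := 1) hT hΘ H.contDiffOn_w).add
        (contDiffOn_partialSnd (n := 1) hT hΘ H.contDiffOn_v)).continuousOn
      continuousOn_const H.div_eq_zero
  rw [MeasureTheory.setIntegral_eq_zero_of_forall_eq_zero hz] at h
  have h1 : ∫ t in (0 : ℝ)..T, v (t, Θ) = ∫ t in (0 : ℝ)..T, c₂ :=
    intervalIntegral.integral_congr fun t ht => H.top t (by rwa [uIcc_of_le hT.le] at ht)
  have h2 : ∫ t in (0 : ℝ)..T, v (t, 0) = ∫ t in (0 : ℝ)..T, c₁ :=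
    intervalIntegral.integral_congr fun t ht => H.bot t (by rwa [uIcc_of_le hT.le] at ht)
  have h3 : ∫ y in (0 : ℝ)..Θ, w (T, y) = ∫ y in (0 : ℝ)..Θ, w (0, y) :=
    intervalIntegral.integral_congr fun t ht => H.periodic_w t (by rwa [uIcc_of_le hΘ.le] at ht)
  rw [h1, h2, h3] at h
  simp only [intervalIntegral.integral_const, sub_zero,
    smul_eq_mul, add_sub_cancel_right] at h
  have : T * (c₁ - c₂) = 0 := by linarith
  rcases mul_eq_zero.1 this with h | h <;> linarith

theorem v_eq_zero (hT : 0 < T) (hΘ : 0 < Θ) (H : IsPeriodicFlow T Θ 0 0 v w) :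
    ∀ q ∈ closedRect 0 T Θ, v q = 0 :=
  eq_zero_of_energy_identity hT hΘ H.contDiffOn_v H.contDiffOn_w H.ne_zero H.div_eq_zero 1
    (fun q hq => by rw [H.vorticity q hq]; ring) H.bot H.top H.periodic_v H.periodic_w
    H.periodic_deriv

/-- If the scaled vorticity is also transported by the periodic part `(w, v - c)` of the field,
then `v` is constant. -/
theorem v_eq_const_of_vorticity {c : ℝ} (hT : 0 < T) (hΘ : 0 < Θ) (H : IsPeriodicFlow T Θ c c v w)
    (h : ∀ q ∈ openRect 0 T Θ,
      c * partialSnd (closedRect 0 T Θ) (scaledVorticity (closedRect 0 T Θ) v w) q =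
        2 * w q * scaledVorticity (closedRect 0 T Θ) v w q) :
    ∀ q ∈ closedRect 0 T Θ, v q = c := by
  have e1 : partialFst (closedRect 0 T Θ) (fun q => v q - c) =
      partialFst (closedRect 0 T Θ) v := by
    funext q; unfold partialFst; rw [fderivWithin_sub_const]
  have e2 : partialSnd (closedRect 0 T Θ) (fun q => v q - c) =
      partialSnd (closedRect 0 T Θ) v := by
    funext q; unfold partialSnd; rw [fderivWithin_sub_const]
  have e3 : scaledVorticity (closedRect 0 T Θ) (fun q => v q - c) w =
      scaledVorticity (closedRect 0 T Θ) v w := by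
    funext q; unfold scaledVorticity; rw [e1]
  -- Replacing v by v - c changes neither ζ nor the divergence. Subtracting the two vorticity
  -- relations leaves w ζ_t + (v - c) ζ_θ = 0, which is the case α = 0.
  have := eq_zero_of_energy_identity hT hΘ (v := fun q => v q - c)
    (H.contDiffOn_v.sub contDiffOn_const) H.contDiffOn_w H.ne_zero
    (fun q hq => by rw [e2]; exact H.div_eq_zero q hq) 0
    (fun q hq => by rw [e3]; linear_combination H.vorticity q hq - h q hq)
    (fun t ht => sub_eq_zero.2 (H.bot t ht)) (fun t ht => sub_eq_zero.2 (H.top t ht))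
    (fun y hy => by simp only [H.periodic_v y hy]) H.periodic_w
    (fun y hy => by rw [e1]; exact H.periodic_deriv y hy)
  intro q hq
  linarith [this q hq]

theorem periodic_scaledVorticity (hT : 0 < T) (hΘ : 0 < Θ) (H : IsPeriodicFlow T Θ c₁ c₂ v w)
    {y : ℝ} (hy : y ∈ Icc 0 Θ) : scaledVorticity (closedRect 0 T Θ) v w (T, y) =
      scaledVorticity (closedRect 0 T Θ) v w (0, y) := by
  unfold scaledVorticity
  rw [H.periodic_deriv y hy, partialSnd_eq_of_eq_on_lines hΘ
    (H.contDiffOn_w.differentiableOn two_ne_zero) ⟨hT.le, le_rfl⟩ ⟨le_rfl, hT.le⟩ hy H.periodic_w]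

/-- Along an edge v_t = 0, so only -w_θ remains. This is how the condition on ∂_θ(r u_r) enters as a
condition on ζ. -/
theorem scaledVorticity_edge {y c A : ℝ} (hT : 0 < T) (H : IsPeriodicFlow T Θ c₁ c₂ v w)
    (hy : y ∈ Icc 0 Θ) (hc : ∀ t ∈ Icc 0 T, v (t, y) = c)
    (hA : ∀ t ∈ Icc 0 T, partialSnd (closedRect 0 T Θ) w (t, y) = A) {t : ℝ} (ht : t ∈ Icc 0 T) :
    scaledVorticity (closedRect 0 T Θ) v w (t, y) = -A := by
  unfold scaledVorticity
  rw [partialFst_eq_zero_of_const_on_line hT (H.contDiffOn_v.differentiableOn two_ne_zero) ht hy hc,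
    hA t ht, zero_sub]

/-- Data on one edge suffice: on the other, the weight ψ - κ in `eq_const_of_transport` is made to
vanish. -/
theorem v_eq_const {c : ℝ} (hT : 0 < T) (hΘ : 0 < Θ) (H : IsPeriodicFlow T Θ c c v w)
    (hc : c ≠ 0)
    (hedge : (∃ A, ∀ t ∈ Icc 0 T, partialSnd (closedRect 0 T Θ) w (t, 0) = A) ∨
      ∃ A, ∀ t ∈ Icc 0 T, partialSnd (closedRect 0 T Θ) w (t, Θ) = A) :
    ∀ q ∈ closedRect 0 T Θ, v q = c := by
  set R := closedRect 0 T Θ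
  set ζ := scaledVorticity R v w
  have hv1 : ContDiffOn ℝ 1 v R := H.contDiffOn_v.of_le one_le_two
  have hw1 : ContDiffOn ℝ 1 w R := H.contDiffOn_w.of_le one_le_two
  have h0T : (0 : ℝ) ∈ Icc 0 T := ⟨le_rfl, hT.le⟩
  have hTT : T ∈ Icc 0 T := ⟨hT.le, le_rfl⟩
  have h0Θ : (0 : ℝ) ∈ Icc 0 Θ := ⟨le_rfl, hΘ.le⟩
  have hΘΘ : Θ ∈ Icc 0 Θ := ⟨hΘ.le, le_rfl⟩
  have hζ1 : ContDiffOn ℝ 1 ζ R := contDiffOn_scaledVorticity hT hΘ H.contDiffOn_v H.contDiffOn_w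
  obtain ⟨ψ, hψ, hψt, hψθ⟩ := exists_potential_closedRect hT hΘ (f := fun q => c - v q) (g := w)
    (contDiffOn_const.sub hv1) hw1 (fun q hq => by
      rw [partialSnd_eq_of_hasDerivAt ((contDiffOn_const.sub hv1).differentiableOn one_ne_zero) hq
        ((hasDerivAt_snd (hv1.differentiableOn one_ne_zero) hq).const_sub c)]
      linarith [H.div_eq_zero q hq])
  have hψd := hψ.differentiableOn one_ne_zero
  have hψbot : ∀ t ∈ Icc 0 T, ψ (t, 0) = ψ (0, 0) := fun t ht =>
    eq_of_partialFst_eq_zero_on_line hT hψd h0Θ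
      (fun s hs => by rw [hψt _ ⟨hs, h0Θ⟩, H.bot s hs, sub_self]) ht h0T
  have hψtop : ∀ t ∈ Icc 0 T, ψ (t, Θ) = ψ (0, Θ) := fun t ht =>
    eq_of_partialFst_eq_zero_on_line hT hψd hΘΘ
      (fun s hs => by rw [hψt _ ⟨hs, hΘΘ⟩, H.top s hs, sub_self]) ht h0T
  -- The difference has θ-derivative w(T, ·) - w(0, ·) = 0, and it vanishes at θ = 0 because ψ is
  -- constant on that edge.
  have hψper : ∀ y ∈ Icc 0 Θ, ψ (T, y) = ψ (0, y) := by
    intro y hy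
    have hder : ∀ s ∈ Icc 0 Θ,
        HasDerivWithinAt (fun s => ψ (T, s) - ψ (0, s)) 0 (Icc 0 Θ) s := by
      intro s hs
      have h1 := hasDerivWithinAt_snd hψd (q := (T, s)) ⟨hTT, hs⟩
      have h2 := hasDerivWithinAt_snd hψd (q := (0, s)) ⟨h0T, hs⟩
      rw [hψθ _ ⟨hTT, hs⟩] at h1
      rw [hψθ _ ⟨h0T, hs⟩] at h2
      have h3 := h1.sub h2
      rwa [H.periodic_w s hs, sub_self] at h3
    have := (convex_Icc (0 : ℝ) Θ).is_const_of_fderivWithin_eq_zero (𝕜 := ℝ)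
      (fun s hs => (hder s hs).differentiableWithinAt)
      (fun s hs => by
        rw [(hder s hs).hasFDerivWithinAt.fderivWithin (uniqueDiffOn_Icc hΘ s hs)]
        ext; simp) hy h0Θ
    simp only [hψbot T hTT, sub_self] at this
    linarith
  -- Integrating factor: along the flow ζ grows at rate 2w and ψ at rate cw, so the exponential
  -- cancels the growth of ζ.
  set h : ℝ × ℝ → ℝ := fun q => ζ q * Real.exp (-2 / c * ψ q) with hh
  have hh1 : ContDiffOn ℝ 1 h R := hζ1.mul (contDiffOn_const.mul hψ).exp
  have hht : ∀ q ∈ openRect 0 T Θ, partialFst R h q =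
      (partialFst R ζ q - 2 / c * ζ q * (c - v q)) * Real.exp (-2 / c * ψ q) := by
    intro q hq
    rw [partialFst_eq_of_hasDerivAt (hh1.differentiableOn one_ne_zero) hq
      ((hasDerivAt_fst (hζ1.differentiableOn one_ne_zero) hq).mul
        ((hasDerivAt_fst hψd hq).const_mul (-2 / c)).exp),
      hψt q (openRect_subset_closedRect hq)]
    ring
  have hhθ : ∀ q ∈ openRect 0 T Θ, partialSnd R h q =
      (partialSnd R ζ q - 2 / c * ζ q * w q) * Real.exp (-2 / c * ψ q) := by
    intro q hq
    rw [partialSnd_eq_of_hasDerivAt (hh1.differentiableOn one_ne_zero) hq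
      ((hasDerivAt_snd (hζ1.differentiableOn one_ne_zero) hq).mul
        ((hasDerivAt_snd hψd hq).const_mul (-2 / c)).exp),
      hψθ q (openRect_subset_closedRect hq)]
    ring
  -- B is the value of h on the edge with constant data, κ the value of ψ on the opposite edge.
  obtain ⟨B, κ, hB0, hBΘ⟩ : ∃ B κ, (∀ t ∈ Icc 0 T, (h (t, 0) - B) * (ψ (t, 0) - κ) = 0) ∧
      ∀ t ∈ Icc 0 T, (h (t, Θ) - B) * (ψ (t, Θ) - κ) = 0 := by
    rcases hedge with ⟨A, hA⟩ | ⟨A, hA⟩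
    · refine ⟨-A * Real.exp (-2 / c * ψ (0, 0)), ψ (0, Θ), fun t ht => ?_, fun t ht => ?_⟩
      · have hζt : ζ (t, 0) = -A := H.scaledVorticity_edge hT h0Θ H.bot hA ht
        simp only [hh, hζt, hψbot t ht]; ring
      · rw [hψtop t ht]; ring
    · refine ⟨-A * Real.exp (-2 / c * ψ (0, Θ)), ψ (0, 0), fun t ht => ?_, fun t ht => ?_⟩
      · rw [hψbot t ht]; ring
      · have hζt : ζ (t, Θ) = -A := H.scaledVorticity_edge hT hΘΘ H.top hA ht
        simp only [hh, hζt, hψtop t ht]; ring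
  have hconst := eq_const_of_transport hT hΘ hv1 hw1 H.ne_zero H.div_eq_zero H.periodic_w hc
    hψ hh1 hψt hψθ
    (fun q hq => by
      rw [hht q hq, hhθ q hq]
      have := H.vorticity q hq
      field_simp
      linear_combination c * Real.exp (-(2 * ψ q / c)) * this)
    hψper (fun y hy => by
      have hζy : ζ (T, y) = ζ (0, y) := H.periodic_scaledVorticity hT hΘ hy
      simp only [hh, hζy, hψper y hy]) hB0 hBΘ
  refine H.v_eq_const_of_vorticity hT hΘ fun q hq => ?_
  have h1 := partialSnd_congr hconst (openRect_subset_closedRect hq)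
  rw [hhθ q hq] at h1
  have h2 : partialSnd R (fun _ => B) q = 0 := by simp [partialSnd]
  rw [h2, mul_eq_zero, or_iff_left (Real.exp_pos _).ne'] at h1
  field_simp at h1
  linarith

/-- The profile of `w` when `v` is constant. -/
theorem profile {c : ℝ} (hT : 0 < T) (hΘ : 0 < Θ) (H : IsPeriodicFlow T Θ c c v w)
    (hvc : ∀ q ∈ closedRect 0 T Θ, v q = c) :
    (∀ q ∈ closedRect 0 T Θ, w q = w (0, q.2)) ∧
      ∃ p, ∀ q ∈ closedRect 0 T Θ,
        c * partialSnd (closedRect 0 T Θ) w q = w q ^ 2 + c ^ 2 + 2 * p := by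
  set R := closedRect 0 T Θ
  have hw1 : ContDiffOn ℝ 1 w R := H.contDiffOn_w.of_le one_le_two
  have hwd := hw1.differentiableOn one_ne_zero
  have hwθ : ContDiffOn ℝ 1 (partialSnd R w) R := contDiffOn_partialSnd (n := 1) hT hΘ H.contDiffOn_w
  have h0T : (0 : ℝ) ∈ Icc 0 T := ⟨le_rfl, hT.le⟩
  have h0Θ : (0 : ℝ) ∈ Icc 0 Θ := ⟨le_rfl, hΘ.le⟩
  have hvt : ∀ q ∈ R, partialFst R v q = 0 := fun q hq =>
    (partialFst_congr hvc hq).trans (by simp [partialFst])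
  have hvθ : ∀ q ∈ R, partialSnd R v q = 0 := fun q hq =>
    (partialSnd_congr hvc hq).trans (by simp [partialSnd])
  have hwt : ∀ q ∈ openRect 0 T Θ, partialFst R w q = 0 := fun q hq => by
    linarith [H.div_eq_zero q hq, hvθ q (openRect_subset_closedRect hq)]
  have hζ : ∀ q ∈ R, scaledVorticity R v w q = -partialSnd R w q := fun q hq => by
    rw [scaledVorticity, hvt q hq, zero_sub]
  have hwfst : ∀ q ∈ R, w q = w (0, q.2) := fun q hq =>
    eq_of_partialFst_eq_zero hT hΘ hw1 hwt hq.2 hq.1 h0T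
  refine ⟨hwfst, ?_⟩
  -- With v = c one has ζ = -w_θ and w_t = 0, so the vorticity equation reads c w_θθ = 2 w w_θ: g is
  -- a first integral.
  set g : ℝ × ℝ → ℝ := fun q => c * partialSnd R w q - w q ^ 2 with hg
  have hg1 : ContDiffOn ℝ 1 g R := (contDiffOn_const.mul hwθ).sub (hw1.pow 2)
  have hgd := hg1.differentiableOn one_ne_zero
  have hwtθ : ∀ q ∈ openRect 0 T Θ, partialFst R (partialSnd R w) q = 0 := by
    intro q hq
    rw [partialFst_partialSnd_comm hT hΘ H.contDiffOn_w hq]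
    have hz := eqOn_closedRect_of_eqOn_openRect hT hΘ
      (contDiffOn_partialFst (n := 1) hT hΘ H.contDiffOn_w).continuousOn continuousOn_const hwt
    exact (partialSnd_congr hz (openRect_subset_closedRect hq)).trans (by simp [partialSnd])
  have hgt : ∀ q ∈ openRect 0 T Θ, partialFst R g q = 0 := by
    intro q hq
    rw [partialFst_eq_of_hasDerivAt hgd hq
      (((hasDerivAt_fst (hwθ.differentiableOn one_ne_zero) hq).const_mul c).sub
        ((hasDerivAt_fst hwd hq).pow 2)), hwtθ q hq, hwt q hq]
    ring
  have hgθ : ∀ q ∈ openRect 0 T Θ, partialSnd R g q = 0 := by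
    intro q hq
    have hqR := openRect_subset_closedRect hq
    rw [partialSnd_eq_of_hasDerivAt hgd hq
      (((hasDerivAt_snd (hwθ.differentiableOn one_ne_zero) hq).const_mul c).sub
        ((hasDerivAt_snd hwd hq).pow 2))]
    have h1 := H.vorticity q hq
    rw [partialFst_congr hζ hqR, partialSnd_congr hζ hqR, hζ q hqR, hvc q hqR,
      partialFst_eq_of_hasDerivAt (f := fun p => -partialSnd R w p)
        (hwθ.differentiableOn one_ne_zero).neg hq
        (hasDerivAt_fst (hwθ.differentiableOn one_ne_zero) hq).neg,
      partialSnd_eq_of_hasDerivAt (f := fun p => -partialSnd R w p)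
        (hwθ.differentiableOn one_ne_zero).neg hq
        (hasDerivAt_snd (hwθ.differentiableOn one_ne_zero) hq).neg, hwtθ q hq] at h1
    simp only [Prod.mk.eta]
    push_cast
    linear_combination -h1
  refine ⟨(g (0, 0) - c ^ 2) / 2, fun q hq => ?_⟩
  have h1 : g q = g (q.1, 0) := eq_of_partialSnd_eq_zero hT hΘ hg1 hgθ hq.1 hq.2 h0Θ
  have h2 : g (q.1, 0) = g (0, 0) := eq_of_partialFst_eq_zero hT hΘ hg1 hgt h0Θ hq.1 h0T
  rw [← h2, ← h1]
  simp only [hg]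
  ring

/-- When `v` vanishes, `w` is constant. -/
theorem w_eq_const (hT : 0 < T) (hΘ : 0 < Θ) (H : IsPeriodicFlow T Θ 0 0 v w)
    {q : ℝ × ℝ} (hq : q ∈ closedRect 0 T Θ) : w q = w (0, 0) := by
  obtain ⟨h1, p, hp⟩ := H.profile hT hΘ (H.v_eq_zero hT hΘ)
  have h0T : (0 : ℝ) ∈ Icc 0 T := ⟨le_rfl, hT.le⟩
  -- For c = 0 the profile equation says that w² is constant; differentiating and dividing by 2w ≠ 0
  -- gives w_θ = 0.
  have hz : ∀ y ∈ Icc 0 Θ, partialSnd (closedRect 0 T Θ) w (0, y) = 0 := by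
    intro y hy
    have hwd := H.contDiffOn_w.differentiableOn two_ne_zero
    have h2 := (hasDerivWithinAt_snd hwd (q := (0, y)) ⟨h0T, hy⟩).pow 2
    have h3 : ∀ s ∈ Icc 0 Θ, w (0, s) ^ 2 = -(2 * p) := fun s hs => by
      have := hp (0, s) ⟨h0T, hs⟩
      linarith
    have h4 := (uniqueDiffOn_Icc hΘ y hy).eq_deriv _ h2
      ((hasDerivWithinAt_const y (Icc 0 Θ) (-(2 * p))).congr h3 (h3 y hy))
    simpa [H.ne_zero (0, y) ⟨h0T, hy⟩] using h4
  rw [h1 q hq]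
  exact eq_of_partialSnd_eq_zero_on_line hΘ (H.contDiffOn_w.differentiableOn two_ne_zero) h0T hz
    hq.2 ⟨le_rfl, hΘ.le⟩

end IsPeriodicFlow

end Flow

/-! ### Polar coordinates -/

theorem eR_eq (θ : ℝ) : eR θ = Real.cos θ • EuclideanSpace.single (0 : Fin 2) (1 : ℝ) +
    Real.sin θ • EuclideanSpace.single (1 : Fin 2) (1 : ℝ) := by
  ext i; fin_cases i <;> simp [eR]

theorem eTheta_eq (θ : ℝ) : eTheta θ = (-Real.sin θ) • EuclideanSpace.single (0 : Fin 2) (1 : ℝ) +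
    Real.cos θ • EuclideanSpace.single (1 : Fin 2) (1 : ℝ) := by
  ext i; fin_cases i <;> simp [eTheta]

theorem single_zero_eq (θ : ℝ) : EuclideanSpace.single (0 : Fin 2) (1 : ℝ) =
    Real.cos θ • eR θ - Real.sin θ • eTheta θ := by
  ext i; fin_cases i
  · simp only [eR, eTheta]; simp; linear_combination -Real.sin_sq_add_cos_sq θ
  · simp [eR, eTheta]; ring

theorem single_one_eq (θ : ℝ) : EuclideanSpace.single (1 : Fin 2) (1 : ℝ) =
    Real.sin θ • eR θ + Real.cos θ • eTheta θ := by
  ext i; fin_cases i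
  · simp [eR, eTheta]; ring
  · simp only [eR, eTheta]; simp; linear_combination -Real.sin_sq_add_cos_sq θ

theorem hasStrictDerivAt_eR (θ : ℝ) : HasStrictDerivAt eR (eTheta θ) θ := by
  rw [funext eR_eq, eTheta_eq]
  exact ((Real.hasStrictDerivAt_cos θ).smul_const _).add
    ((Real.hasStrictDerivAt_sin θ).smul_const _)

theorem hasDerivAt_eTheta (θ : ℝ) : HasDerivAt eTheta (-eR θ) θ := by
  rw [funext eTheta_eq, eR_eq, neg_add, ← neg_smul, ← neg_smul]
  exact ((Real.hasDerivAt_sin θ).neg.smul_const _).add ((Real.hasDerivAt_cos θ).smul_const _)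

theorem inner_eR_eR (θ : ℝ) : inner ℝ (eR θ) (eR θ) = 1 := by
  simp only [PiLp.inner_apply, Fin.sum_univ_two, eR]; simp

theorem inner_eTheta_eTheta (θ : ℝ) : inner ℝ (eTheta θ) (eTheta θ) = 1 := by
  simp only [PiLp.inner_apply, Fin.sum_univ_two, eTheta]; simp

theorem inner_eTheta_eR (θ : ℝ) : inner ℝ (eTheta θ) (eR θ) = 0 := by
  simp [eTheta, eR, PiLp.inner_apply, Fin.sum_univ_two]
  ring

theorem inner_eR_eTheta (θ : ℝ) : inner ℝ (eR θ) (eTheta θ) = 0 := by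
  rw [real_inner_comm, inner_eTheta_eR]

theorem norm_eR (θ : ℝ) : ‖eR θ‖ = 1 := by
  have h := real_inner_self_eq_norm_sq (eR θ)
  rw [inner_eR_eR] at h
  nlinarith [norm_nonneg (eR θ)]

theorem hasStrictFDerivAt_polarPoint (q : ℝ × ℝ) :
    HasStrictFDerivAt polarPoint
      ((ContinuousLinearMap.fst ℝ ℝ ℝ).smulRight (eR q.2) +
        (ContinuousLinearMap.snd ℝ ℝ ℝ).smulRight (q.1 • eTheta q.2)) q := by
  have h := hasStrictFDerivAt_fst.smul
    ((hasStrictDerivAt_eR q.2).hasStrictFDerivAt.comp q hasStrictFDerivAt_snd)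
  refine h.congr_fderiv ?_
  ext x <;> simp

/-- The sector is a neighbourhood of each of its points, described in polar coordinates. -/
theorem sector_mem_nhds {a b θ₀ : ℝ} (ha : 0 < a) {q : ℝ × ℝ} (hq : q ∈ openRect a b θ₀) :
    sector a b θ₀ ∈ nhds (polarPoint q) := by
  have hr : q.1 ≠ 0 := (ha.trans hq.1.1).ne'
  -- A strictly differentiable map with surjective derivative is locally open, so injectivity plays
  -- no role here. Surjectivity uses r ≠ 0.
  have h := (hasStrictFDerivAt_polarPoint q).map_nhds_eq_of_surj (by
    rw [LinearMap.range_eq_top]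
    intro y
    refine ⟨(Real.cos q.2 * y 0 + Real.sin q.2 * y 1,
      (-Real.sin q.2 * y 0 + Real.cos q.2 * y 1) / q.1), ?_⟩
    have hy : y = y 0 • EuclideanSpace.single (0 : Fin 2) (1 : ℝ) +
        y 1 • EuclideanSpace.single (1 : Fin 2) (1 : ℝ) := by
      ext i; fin_cases i <;> simp
    conv_rhs => rw [hy, single_zero_eq q.2, single_one_eq q.2]
    simp only [ContinuousLinearMap.coe_coe, add_apply,
      ContinuousLinearMap.smulRight_apply, ContinuousLinearMap.coe_fst',
      ContinuousLinearMap.coe_snd', smul_smul, div_mul_cancel₀ _ hr]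
    module)
  rw [← h]
  exact Filter.image_mem_map (isOpen_openRect.mem_nhds hq)

theorem trace_eq_of_polar_basis (L : Plane →L[ℝ] Plane) (θ : ℝ) {x y z w : ℝ}
    (hR : L (eR θ) = x • eTheta θ + y • eR θ) (hT : L (eTheta θ) = z • eTheta θ + w • eR θ) :
    ∑ i : Fin 2, L (EuclideanSpace.single i 1) i = y + z := by
  rw [Fin.sum_univ_two, single_zero_eq θ, single_one_eq θ]
  simp only [map_sub, map_add, map_smul, hR, hT]
  simp [eR, eTheta]
  linear_combination (y + z) * Real.sin_sq_add_cos_sq θ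

/-- Homogeneity concerns points of the plane, so the angle must be recoverable. Two angles in the
open interval (0, θ₀) differ by less than 2π, which excludes every nonzero winding number k. -/
theorem polarPoint_smul_eq {a b θ₀ : ℝ} (ha : 0 < a) (hθ₀ : θ₀ ≤ 2 * Real.pi) {q q' : ℝ × ℝ}
    (hq : q ∈ openRect a b θ₀) (hq' : q' ∈ openRect a b θ₀) {t : ℝ} (ht : 0 < t)
    (h : t • polarPoint q = polarPoint q') : q' = (t * q.1, q.2) := by
  have hr : 0 < q.1 := ha.trans hq.1.1
  have hr' : 0 < q'.1 := ha.trans hq'.1.1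
  unfold polarPoint at h
  rw [smul_smul] at h
  have h1 : t * q.1 = q'.1 := by
    have := congrArg norm h
    simpa [norm_smul, norm_eR, abs_of_pos ht, abs_of_pos hr, abs_of_pos hr'] using this
  rw [h1] at h
  have h2 : eR q.2 = eR q'.2 := smul_right_injective _ hr'.ne' h
  have hc : Real.cos q.2 = Real.cos q'.2 := by simpa [eR] using congrArg (fun y : Plane => y 0) h2
  have hs : Real.sin q.2 = Real.sin q'.2 := by simpa [eR] using congrArg (fun y : Plane => y 1) h2
  obtain ⟨k, hk⟩ := Real.Angle.angle_eq_iff_two_pi_dvd_sub.1 (Real.Angle.cos_sin_inj hc hs)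
  have hk1 : (k : ℝ) < 1 := by
    by_contra! hcon
    nlinarith [hq.2.1, hq.2.2, hq'.2.1, hq'.2.2, Real.pi_pos]
  have hk2 : (-1 : ℝ) < k := by
    by_contra! hcon
    nlinarith [hq.2.1, hq.2.2, hq'.2.1, hq'.2.2, Real.pi_pos]
  have hk0 : k = 0 := by
    have h3 : k < 1 := by exact_mod_cast hk1
    have h4 : -1 < k := by exact_mod_cast hk2
    omega
  rw [hk0, Int.cast_zero, mul_zero] at hk
  ext
  · exact h1.symm
  · linarith

/-- If `dp = A dx + B dy` near `q` then the mixed derivatives agree. -/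
theorem partialSnd_eq_partialFst_of_hasFDerivAt {a b Θ : ℝ} {p A B : ℝ × ℝ → ℝ} {q : ℝ × ℝ}
    (hp : ∀ q ∈ openRect a b Θ, HasFDerivAt p
      (A q • ContinuousLinearMap.fst ℝ ℝ ℝ + B q • ContinuousLinearMap.snd ℝ ℝ ℝ) q)
    (hA : DifferentiableOn ℝ A (closedRect a b Θ)) (hB : DifferentiableOn ℝ B (closedRect a b Θ))
    (hq : q ∈ openRect a b Θ) :
    partialSnd (closedRect a b Θ) A q = partialFst (closedRect a b Θ) B q := by
  have h := second_derivative_symmetric_of_eventually (𝕜 := ℝ)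
    (f' := fun q => A q • ContinuousLinearMap.fst ℝ ℝ ℝ + B q • ContinuousLinearMap.snd ℝ ℝ ℝ)
    (Filter.eventually_of_mem (isOpen_openRect.mem_nhds hq) hp)
    (((hasFDerivAt_of_mem_openRect hA hq).smul_const (ContinuousLinearMap.fst ℝ ℝ ℝ)).add
      ((hasFDerivAt_of_mem_openRect hB hq).smul_const (ContinuousLinearMap.snd ℝ ℝ ℝ)))
    (0, 1) (1, 0)
  simpa [partialFst, partialSnd] using h

/-! ### The Euler equations in the coordinates `(log r, θ)` -/

/-- The function `r f(r, θ)` in the coordinates `(log r, θ)`. -/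
noncomputable def logPolar (f : ℝ × ℝ → ℝ) (q : ℝ × ℝ) : ℝ :=
  Real.exp q.1 * f (Real.exp q.1, q.2)

section LogPolar

variable {θ₀ : ℝ} {f : ℝ × ℝ → ℝ} {q : ℝ × ℝ}

theorem exp_mem_Icc {t : ℝ} (ht : t ∈ Icc 0 (Real.log 2)) : Real.exp t ∈ Icc (1 : ℝ) 2 := by
  constructor
  · exact Real.one_le_exp ht.1
  · rw [← Real.le_log_iff_exp_le two_pos]; exact ht.2

theorem exp_mem_Ioo {t : ℝ} (ht : t ∈ Ioo 0 (Real.log 2)) : Real.exp t ∈ Ioo (1 : ℝ) 2 := by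
  constructor
  · exact Real.one_lt_exp_iff.2 ht.1
  · rw [← Real.lt_log_iff_exp_lt two_pos]; exact ht.2

theorem log_mem_Icc {r : ℝ} (hr : r ∈ Icc (1 : ℝ) 2) : Real.log r ∈ Icc 0 (Real.log 2) :=
  ⟨Real.log_nonneg hr.1, Real.log_le_log (by linarith [hr.1]) hr.2⟩

theorem log_mem_Ioo {r : ℝ} (hr : r ∈ Ioo (1 : ℝ) 2) : Real.log r ∈ Ioo 0 (Real.log 2) :=
  ⟨Real.log_pos hr.1, Real.log_lt_log (by linarith [hr.1]) hr.2⟩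

theorem logPolar_log {r θ : ℝ} (hr : 0 < r) : logPolar f (Real.log r, θ) = r * f (r, θ) := by
  simp [logPolar, Real.exp_log hr]

theorem contDiffOn_logPolar (hf : ContDiffOn ℝ 2 f (closedRect 1 2 θ₀)) :
    ContDiffOn ℝ 2 (logPolar f) (closedRect 0 (Real.log 2) θ₀) := by
  have h1 : ContDiff ℝ 2 fun q : ℝ × ℝ => Real.exp q.1 := Real.contDiff_exp.comp contDiff_fst
  exact h1.contDiffOn.mul (hf.comp (h1.prodMk contDiff_snd).contDiffOn
    fun q hq => ⟨exp_mem_Icc hq.1, hq.2⟩)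

theorem logPolar_zero (θ : ℝ) : logPolar f (0, θ) = f (1, θ) := by simp [logPolar]

theorem logPolar_log_two (θ : ℝ) : logPolar f (Real.log 2, θ) = 2 * f (2, θ) :=
  logPolar_log two_pos

theorem partialFst_logPolar (hf : ContDiffOn ℝ 2 f (closedRect 1 2 θ₀))
    {t θ : ℝ} (ht : t ∈ Icc 0 (Real.log 2)) (hθ : θ ∈ Icc 0 θ₀) :
    partialFst (closedRect 0 (Real.log 2) θ₀) (logPolar f) (t, θ) =
      Real.exp t * f (Real.exp t, θ) +
        Real.exp t ^ 2 * derivWithin (fun r => f (r, θ)) (Icc 1 2) (Real.exp t) := by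
  have h1 := hasDerivWithinAt_fst ((contDiffOn_logPolar hf).differentiableOn two_ne_zero)
    (q := (t, θ)) ⟨ht, hθ⟩
  have h2 := hasDerivWithinAt_fst (hf.differentiableOn two_ne_zero)
    (q := (Real.exp t, θ)) ⟨exp_mem_Icc ht, hθ⟩
  have h3 := HasDerivWithinAt.comp (h₂ := fun r => f (r, θ)) t h2
    (Real.hasDerivAt_exp t).hasDerivWithinAt
    (fun s (hs : s ∈ Icc 0 (Real.log 2)) => exp_mem_Icc hs)
  have h4 := (Real.hasDerivAt_exp t).hasDerivWithinAt.mul h3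
  have h5 := (uniqueDiffOn_Icc (Real.log_pos one_lt_two) t ht).eq_deriv _ h1 h4
  rw [h5, h2.derivWithin (uniqueDiffOn_Icc one_lt_two _ (exp_mem_Icc ht))]
  simp only [Function.comp]
  ring

theorem partialSnd_logPolar (hθ₀ : 0 < θ₀) (hf : ContDiffOn ℝ 2 f (closedRect 1 2 θ₀))
    {t θ : ℝ} (ht : t ∈ Icc 0 (Real.log 2)) (hθ : θ ∈ Icc 0 θ₀) :
    partialSnd (closedRect 0 (Real.log 2) θ₀) (logPolar f) (t, θ) =
      derivWithin (fun s => Real.exp t * f (Real.exp t, s)) (Icc 0 θ₀) θ :=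
  ((hasDerivWithinAt_snd ((contDiffOn_logPolar hf).differentiableOn two_ne_zero)
    (q := (t, θ)) ⟨ht, hθ⟩).derivWithin (uniqueDiffOn_Icc hθ₀ θ hθ)).symm

/-- The radial derivative of the pressure, in the coordinates `(log r, θ)`. -/
noncomputable def pressureFst (R : Set (ℝ × ℝ)) (v w : ℝ × ℝ → ℝ) (q : ℝ × ℝ) : ℝ :=
  -(Real.exp (-2 * q.1) * (v q * (partialSnd R w q - v q) + w q * (partialFst R w q - w q)))

/-- The angular derivative of the pressure, in the coordinates `(log r, θ)`. -/
noncomputable def pressureSnd (R : Set (ℝ × ℝ)) (v w : ℝ × ℝ → ℝ) (q : ℝ × ℝ) : ℝ :=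
  -(Real.exp (-2 * q.1) * (v q * (partialSnd R v q + w q) + w q * (partialFst R v q - v q)))

variable {u : Plane → Plane} {P : Plane → ℝ} {ur uθ : ℝ × ℝ → ℝ}

/-- The columns of Du in the frame (e_r, e_θ) come from differentiating u along coordinate lines,
where e_r and e_θ rotate into each other. Their trace is the divergence, and applying Du to u gives
the pressure gradient. -/
theorem euler_logPolar (hu : IsC2WithPolarComponents 1 2 θ₀ u ur uθ)
    (heuler : IsEulerSolution (sector 1 2 θ₀) u P)
    (hq : q ∈ openRect 0 (Real.log 2) θ₀) :
    partialFst (closedRect 0 (Real.log 2) θ₀) (logPolar ur) q +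
      partialSnd (closedRect 0 (Real.log 2) θ₀) (logPolar uθ) q = 0 ∧
    HasFDerivAt (fun q : ℝ × ℝ => P (polarPoint (Real.exp q.1, q.2)))
      (pressureFst (closedRect 0 (Real.log 2) θ₀) (logPolar uθ) (logPolar ur) q •
          ContinuousLinearMap.fst ℝ ℝ ℝ +
        pressureSnd (closedRect 0 (Real.log 2) θ₀) (logPolar uθ) (logPolar ur) q •
          ContinuousLinearMap.snd ℝ ℝ ℝ) q := by
  obtain ⟨hur2, huθ2, hupolar⟩ := hu
  obtain ⟨hud, hPd, heq⟩ := heuler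
  set R := closedRect 0 (Real.log 2) θ₀
  set V := logPolar uθ with hV
  set W := logPolar ur with hW
  set E := Real.exp q.1 with hE
  have hEpos : 0 < E := Real.exp_pos _
  have hpt : ∀ p ∈ openRect 0 (Real.log 2) θ₀, (Real.exp p.1, p.2) ∈ openRect 1 2 θ₀ :=
    fun p hp => ⟨exp_mem_Ioo hp.1, hp.2⟩
  set x := polarPoint (E, q.2) with hx
  have hxS : x ∈ sector 1 2 θ₀ := mem_image_of_mem _ (hpt q hq)
  have hnhds := sector_mem_nhds one_pos (hpt q hq)
  have hdu : HasFDerivAt u (fderiv ℝ u x) x := (hud.differentiableAt hnhds).hasFDerivAt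
  have hdP : HasFDerivAt P (fderiv ℝ P x) x := (hPd.differentiableAt hnhds).hasFDerivAt
  set L := fderiv ℝ u x
  -- The factor 1/r = e^{-t} is written e^{-2t} e^t, so that e^t cancels the chain-rule factor E in
  -- `hLR` and `hLT`.
  have huflat : ∀ p ∈ openRect 0 (Real.log 2) θ₀, u (polarPoint (Real.exp p.1, p.2)) =
      Real.exp (-2 * p.1) • Real.exp p.1 • (V p • eTheta p.2 + W p • eR p.2) := by
    intro p hp
    rw [hupolar _ (hpt p hp)]
    have h1 : Real.exp (-2 * p.1) * (Real.exp p.1 * Real.exp p.1) = 1 := by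
      rw [← Real.exp_add, ← Real.exp_add, ← Real.exp_zero]; congr 1; ring
    simp only [hV, hW, logPolar, smul_add, smul_smul]
    congr 2
    · linear_combination -(uθ (Real.exp p.1, p.2)) * h1
    · linear_combination -(ur (Real.exp p.1, p.2)) * h1
  have hΦ : HasFDerivAt (fun p : ℝ × ℝ => polarPoint (Real.exp p.1, p.2))
      ((ContinuousLinearMap.fst ℝ ℝ ℝ).smulRight (E • eR q.2) +
        (ContinuousLinearMap.snd ℝ ℝ ℝ).smulRight (E • eTheta q.2)) q := by
    have h1 : HasFDerivAt (fun p : ℝ × ℝ => (Real.exp p.1, p.2))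
        ((E • ContinuousLinearMap.fst ℝ ℝ ℝ).prod (ContinuousLinearMap.snd ℝ ℝ ℝ)) q :=
      hasFDerivAt_fst.exp.prodMk hasFDerivAt_snd
    refine ((hasStrictFDerivAt_polarPoint (E, q.2)).hasFDerivAt.comp q h1).congr_fderiv ?_
    ext y <;> simp
  have hVd := (contDiffOn_logPolar huθ2).differentiableOn two_ne_zero
  have hWd := (contDiffOn_logPolar hur2).differentiableOn two_ne_zero
  have hLR : L (eR q.2) = (Real.exp (-2 * q.1) * (partialFst R V q - V q)) • eTheta q.2 +
      (Real.exp (-2 * q.1) * (partialFst R W q - W q)) • eR q.2 := by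
    have h1 : HasDerivAt (fun s : ℝ => (s, q.2)) ((1 : ℝ), (0 : ℝ)) q.1 :=
      (hasDerivAt_id _).prodMk (hasDerivAt_const _ _)
    have h2 := HasFDerivAt.comp_hasDerivAt (f := fun s : ℝ => (s, q.2)) q.1
      (HasFDerivAt.comp (g := u) q hdu hΦ) h1
    have h3 : HasDerivAt (fun s : ℝ => Real.exp (-2 * s) • Real.exp s •
        (V (s, q.2) • eTheta q.2 + W (s, q.2) • eR q.2)) _ q.1 :=
      ((hasDerivAt_id q.1).const_mul (-2)).exp.smul ((Real.hasDerivAt_exp q.1).smul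
        (((hasDerivAt_fst hVd hq).smul_const (eTheta q.2)).add
          ((hasDerivAt_fst hWd hq).smul_const (eR q.2))))
    have h4 := h2.unique (h3.congr_of_eventuallyEq (Filter.eventually_of_mem
      (Ioo_mem_nhds hq.1.1 hq.1.2) fun s hs => huflat (s, q.2) ⟨hs, hq.2⟩))
    simp only [ContinuousLinearMap.comp_apply, add_apply, ContinuousLinearMap.smulRight_apply,
      ContinuousLinearMap.coe_fst', ContinuousLinearMap.coe_snd', one_smul, zero_smul, add_zero,
      map_smul] at h4
    have h5 : E • L (eR q.2) = E • ((Real.exp (-2 * q.1) * (partialFst R V q - V q)) • eTheta q.2 +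
      (Real.exp (-2 * q.1) * (partialFst R W q - W q)) • eR q.2) := by
      rw [h4]
      simp only [id, mul_one]
      module
    exact smul_right_injective _ hEpos.ne' h5
  have hLT : L (eTheta q.2) = (Real.exp (-2 * q.1) * (partialSnd R V q + W q)) • eTheta q.2 +
      (Real.exp (-2 * q.1) * (partialSnd R W q - V q)) • eR q.2 := by
    have h1 : HasDerivAt (fun s : ℝ => (q.1, s)) ((0 : ℝ), (1 : ℝ)) q.2 :=
      (hasDerivAt_const _ _).prodMk (hasDerivAt_id _)
    have h2 := HasFDerivAt.comp_hasDerivAt (f := fun s : ℝ => (q.1, s)) q.2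
      (HasFDerivAt.comp (g := u) q hdu hΦ) h1
    have h3 : HasDerivAt (fun s : ℝ => Real.exp (-2 * q.1) • Real.exp q.1 •
        (V (q.1, s) • eTheta s + W (q.1, s) • eR s)) _ q.2 :=
      ((((hasDerivAt_snd hVd hq).smul (hasDerivAt_eTheta q.2)).add
          ((hasDerivAt_snd hWd hq).smul (hasStrictDerivAt_eR q.2).hasDerivAt)).const_smul
            (Real.exp q.1)).const_smul (Real.exp (-2 * q.1))
    have h4 := h2.unique (h3.congr_of_eventuallyEq (Filter.eventually_of_mem
      (Ioo_mem_nhds hq.2.1 hq.2.2) fun s hs => huflat (q.1, s) ⟨hq.1, hs⟩))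
    simp only [ContinuousLinearMap.comp_apply, add_apply, ContinuousLinearMap.smulRight_apply,
      ContinuousLinearMap.coe_fst', ContinuousLinearMap.coe_snd', one_smul, zero_smul, zero_add,
      map_smul] at h4
    have h5 : E • L (eTheta q.2) = E • ((Real.exp (-2 * q.1) * (partialSnd R V q + W q)) •
        eTheta q.2 + (Real.exp (-2 * q.1) * (partialSnd R W q - V q)) • eR q.2) := by
      rw [h4]
      simp only [Prod.mk.eta]
      module
    exact smul_right_injective _ hEpos.ne' h5
  obtain ⟨hmom, hdiv⟩ := heq x hxS
  constructor
  · have h1 := (trace_eq_of_polar_basis L q.2 hLR hLT).symm.trans hdiv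
    have h2 := (Real.exp_pos (-2 * q.1)).ne'
    have h3 : Real.exp (-2 * q.1) * (partialFst R W q + partialSnd R V q) = 0 := by
      linear_combination h1
    exact (mul_eq_zero.1 h3).resolve_left h2
  · have hEE : Real.exp (-2 * q.1) * (E * E) = 1 := by
      rw [hE, ← Real.exp_add, ← Real.exp_add, ← Real.exp_zero]; congr 1; ring
    have hgrad : gradient P x = -L (u x) := by rw [hmom, neg_neg]
    have hux : u x = Real.exp (-2 * q.1) • E • (V q • eTheta q.2 + W q • eR q.2) := huflat q hq
    have hPR : E * fderiv ℝ P x (eR q.2) = pressureFst R V W q := by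
      rw [← inner_gradient_left, hgrad, hux]
      simp only [map_smul, map_add, hLR, hLT, inner_neg_left, inner_smul_left, inner_add_left,
        inner_eR_eR, inner_eTheta_eR, RCLike.conj_to_real, pressureFst]
      linear_combination (-(Real.exp (-2 * q.1) * (V q * (partialSnd R W q - V q) +
        W q * (partialFst R W q - W q)))) * hEE
    have hPT : E * fderiv ℝ P x (eTheta q.2) = pressureSnd R V W q := by
      rw [← inner_gradient_left, hgrad, hux]
      simp only [map_smul, map_add, hLR, hLT, inner_neg_left, inner_smul_left, inner_add_left,
        inner_eR_eTheta, inner_eTheta_eTheta, RCLike.conj_to_real, pressureSnd]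
      linear_combination (-(Real.exp (-2 * q.1) * (V q * (partialSnd R V q + W q) +
        W q * (partialFst R V q - V q)))) * hEE
    refine (HasFDerivAt.comp (g := P) q hdP hΦ).congr_fderiv ?_
    ext <;> simp [← hPR, ← hPT]

end LogPolar

/-! ### Passage from the Euler system to a periodic flow, and back. -/

section Euler

variable {θ₀ : ℝ} {u : Plane → Plane} {P : Plane → ℝ} {ur uθ : ℝ × ℝ → ℝ}

/-- P is only assumed differentiable, but its gradient is a C¹ expression in u, so its mixed second
derivatives exist and agree. -/
theorem vorticity_logPolar (hθ₀ : 0 < θ₀) (hu : IsC2WithPolarComponents 1 2 θ₀ u ur uθ)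
    (heuler : IsEulerSolution (sector 1 2 θ₀) u P) {q : ℝ × ℝ}
    (hq : q ∈ openRect 0 (Real.log 2) θ₀) :
    logPolar ur q * partialFst (closedRect 0 (Real.log 2) θ₀) (scaledVorticity
        (closedRect 0 (Real.log 2) θ₀) (logPolar uθ) (logPolar ur)) q +
      logPolar uθ q * partialSnd (closedRect 0 (Real.log 2) θ₀) (scaledVorticity
        (closedRect 0 (Real.log 2) θ₀) (logPolar uθ) (logPolar ur)) q =
      2 * logPolar ur q * scaledVorticity
        (closedRect 0 (Real.log 2) θ₀) (logPolar uθ) (logPolar ur) q := by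
  have hT : 0 < Real.log 2 := Real.log_pos one_lt_two
  have hv := contDiffOn_logPolar hu.2.1
  have hw := contDiffOn_logPolar hu.1
  set R := closedRect 0 (Real.log 2) θ₀
  set v := logPolar uθ
  set w := logPolar ur
  have hv1 := hv.of_le one_le_two
  have hw1 := hw.of_le one_le_two
  have hvt : ContDiffOn ℝ 1 (partialFst R v) R := contDiffOn_partialFst (n := 1) hT hθ₀ hv
  have hwt : ContDiffOn ℝ 1 (partialFst R w) R := contDiffOn_partialFst (n := 1) hT hθ₀ hw
  have hvθ : ContDiffOn ℝ 1 (partialSnd R v) R := contDiffOn_partialSnd (n := 1) hT hθ₀ hv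
  have hwθ : ContDiffOn ℝ 1 (partialSnd R w) R := contDiffOn_partialSnd (n := 1) hT hθ₀ hw
  have hexp : ContDiffOn ℝ 1 (fun q : ℝ × ℝ => Real.exp (-2 * q.1)) R :=
    (Real.contDiff_exp.comp (contDiff_const.mul contDiff_fst)).contDiffOn
  have hA : ContDiffOn ℝ 1 (pressureFst R v w) R :=
    (hexp.mul ((hv1.mul (hwθ.sub hv1)).add (hw1.mul (hwt.sub hw1)))).neg
  have hB : ContDiffOn ℝ 1 (pressureSnd R v w) R :=
    (hexp.mul ((hv1.mul (hvθ.add hw1)).add (hw1.mul (hvt.sub hv1)))).neg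
  have hAd := hA.differentiableOn one_ne_zero
  have hBd := hB.differentiableOn one_ne_zero
  have hcross := partialSnd_eq_partialFst_of_hasFDerivAt
    (fun q hq => (euler_logPolar hu heuler hq).2) hAd hBd hq
  have d1v := hasDerivAt_fst (hv.differentiableOn two_ne_zero) hq
  have d2v := hasDerivAt_snd (hv.differentiableOn two_ne_zero) hq
  have d1w := hasDerivAt_fst (hw.differentiableOn two_ne_zero) hq
  have d2w := hasDerivAt_snd (hw.differentiableOn two_ne_zero) hq
  have d1vt := hasDerivAt_fst (hvt.differentiableOn one_ne_zero) hq
  have d2vt := hasDerivAt_snd (hvt.differentiableOn one_ne_zero) hq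
  have d2wt := hasDerivAt_snd (hwt.differentiableOn one_ne_zero) hq
  have d1vθ := hasDerivAt_fst (hvθ.differentiableOn one_ne_zero) hq
  have d1wθ := hasDerivAt_fst (hwθ.differentiableOn one_ne_zero) hq
  have d2wθ := hasDerivAt_snd (hwθ.differentiableOn one_ne_zero) hq
  have cv := partialFst_partialSnd_comm hT hθ₀ hv hq
  have cw := partialFst_partialSnd_comm hT hθ₀ hw hq
  have hζ := (contDiffOn_scaledVorticity hT hθ₀ hv hw).differentiableOn one_ne_zero
  have e0 := (euler_logPolar hu heuler hq).1
  have e1 := partialFst_eq_of_hasDerivAt hζ hq (d1vt.sub d1wθ)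
  have e2 := partialSnd_eq_of_hasDerivAt hζ hq (d2vt.sub d2wθ)
  have e3 := partialSnd_eq_of_hasDerivAt hAd hq
    (((d2v.mul (d2wθ.sub d2v)).add (d2w.mul (d2wt.sub d2w))).const_mul (Real.exp (-2 * q.1))).neg
  have e4 := partialFst_eq_of_hasDerivAt hBd hq
    (((hasDerivAt_id q.1).const_mul (-2)).exp.mul
      ((d1v.mul (d1vθ.add d1w)).add (d1w.mul (d1vt.sub d1v)))).neg
  rw [e3, e4] at hcross
  rw [e1, e2]
  simp only [scaledVorticity]
  simp only [Pi.sub_apply, Pi.add_apply, Pi.mul_apply, Prod.mk.eta, id] at hcross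
  rw [cv, cw.symm] at hcross
  -- Equality of the mixed derivatives is the vorticity equation up to a multiple of the divergence,
  -- which `e0` removes.
  have h0 : Real.exp (-2 * q.1) * (w q * (partialFst R (partialFst R v) q -
      partialFst R (partialSnd R w) q) + v q * (partialSnd R (partialFst R v) q -
      partialSnd R (partialSnd R w) q) - 2 * w q * (partialFst R v q - partialSnd R w q)) = 0 := by
    linear_combination hcross + Real.exp (-2 * q.1) *
      (partialSnd R w q - partialFst R v q) * e0
  have h1 := (mul_eq_zero.1 h0).resolve_left (Real.exp_pos _).ne'
  linarith

theorem isPeriodicFlow_logPolar (hθ₀ : 0 < θ₀) (hu : IsC2WithPolarComponents 1 2 θ₀ u ur uθ)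
    (heuler : IsEulerSolution (sector 1 2 θ₀) u P)
    (hur : ∀ q ∈ closedRect 1 2 θ₀, 0 < |ur q|) {c₁ c₂ : ℝ}
    (hbot : ∀ r ∈ Set.Icc (1 : ℝ) 2, uθ (r, 0) = c₁ / r)
    (htop : ∀ r ∈ Set.Icc (1 : ℝ) 2, uθ (r, θ₀) = c₂ / r)
    (hper_r : ∀ θ ∈ Set.Icc 0 θ₀, ur (1, θ) = 2 * ur (2, θ))
    (hper_θ : ∀ θ ∈ Set.Icc 0 θ₀, uθ (1, θ) = 2 * uθ (2, θ))
    (hper_d : ∀ θ ∈ Set.Icc 0 θ₀,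
      derivWithin (fun r => uθ (r, θ)) (Set.Icc 1 2) 1 =
        2 ^ 2 * derivWithin (fun r => uθ (r, θ)) (Set.Icc 1 2) 2) :
    IsPeriodicFlow (Real.log 2) θ₀ c₁ c₂ (logPolar uθ) (logPolar ur) where
  contDiffOn_v := contDiffOn_logPolar hu.2.1
  contDiffOn_w := contDiffOn_logPolar hu.1
  ne_zero q hq := mul_ne_zero (Real.exp_pos _).ne'
    (abs_pos.1 (hur (Real.exp q.1, q.2) ⟨exp_mem_Icc hq.1, hq.2⟩))
  div_eq_zero q hq := (euler_logPolar hu heuler hq).1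
  vorticity q hq := vorticity_logPolar hθ₀ hu heuler hq
  bot t ht := by
    rw [logPolar, hbot _ (exp_mem_Icc ht), mul_div_cancel₀ _ (Real.exp_pos _).ne']
  top t ht := by
    rw [logPolar, htop _ (exp_mem_Icc ht), mul_div_cancel₀ _ (Real.exp_pos _).ne']
  periodic_v y hy := by rw [logPolar_log_two, logPolar_zero, hper_θ y hy]
  periodic_w y hy := by rw [logPolar_log_two, logPolar_zero, hper_r y hy]
  periodic_deriv y hy := by
    have hT := (Real.log_pos one_lt_two).le
    rw [partialFst_logPolar hu.2.1 ⟨hT, le_rfl⟩ hy, partialFst_logPolar hu.2.1 ⟨le_rfl, hT⟩ hy,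
      Real.exp_log two_pos, Real.exp_zero, hper_d y hy, hper_θ y hy]
    ring

/-- For v = c the angular pressure derivative vanishes and the profile equation turns the radial one
into -2p e^{-2t}. Thus P - p/r² has zero derivative on a connected set, and the constant in the
profile equation is the pressure coefficient. -/
theorem hasHomogeneousForm_of_logPolar (hθ₀' : θ₀ ≤ 2 * Real.pi)
    (hu : IsC2WithPolarComponents 1 2 θ₀ u ur uθ) (heuler : IsEulerSolution (sector 1 2 θ₀) u P)
    {c p : ℝ} {f : ℝ → ℝ}
    (hv : ∀ q ∈ closedRect 0 (Real.log 2) θ₀, logPolar uθ q = c)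
    (hw : ∀ q ∈ closedRect 0 (Real.log 2) θ₀, logPolar ur q = f q.2)
    (hode : ∀ q ∈ closedRect 0 (Real.log 2) θ₀,
      c * partialSnd (closedRect 0 (Real.log 2) θ₀) (logPolar ur) q =
        logPolar ur q ^ 2 + c ^ 2 + 2 * p) :
    HasHomogeneousForm 1 2 θ₀ u ur uθ P (fun _ => c) f p := by
  have hform : ∀ q ∈ closedRect 1 2 θ₀, uθ q = c / q.1 ∧ ur q = f q.2 / q.1 := by
    rintro ⟨r, θ⟩ ⟨hr, hθ⟩
    have hr0 : (0 : ℝ) < r := lt_of_lt_of_le one_pos hr.1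
    have h1 := hv (Real.log r, θ) ⟨log_mem_Icc hr, hθ⟩
    have h2 := hw (Real.log r, θ) ⟨log_mem_Icc hr, hθ⟩
    rw [logPolar_log hr0] at h1 h2
    exact ⟨by rw [← h1]; field_simp, by rw [← h2]; field_simp⟩
  have hux : ∀ q ∈ openRect 1 2 θ₀,
      u (polarPoint q) = (c / q.1) • eTheta q.2 + (f q.2 / q.1) • eR q.2 := by
    intro q hq
    obtain ⟨h1, h2⟩ := hform q (openRect_subset_closedRect hq)
    rw [hu.2.2 q hq, h1, h2]
  obtain ⟨C, hC⟩ : ∃ C, ∀ q ∈ openRect 0 (Real.log 2) θ₀,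
      P (polarPoint (Real.exp q.1, q.2)) - p * Real.exp (-2 * q.1) = C := by
    have hder : ∀ q ∈ openRect 0 (Real.log 2) θ₀, HasFDerivAt
        (fun q : ℝ × ℝ => P (polarPoint (Real.exp q.1, q.2)) - p * Real.exp (-2 * q.1))
        (0 : ℝ × ℝ →L[ℝ] ℝ) q := by
      intro q hq
      have hqR := openRect_subset_closedRect hq
      have hexp : HasFDerivAt (fun q : ℝ × ℝ => p * Real.exp (-2 * q.1))
          (p • Real.exp (-2 * q.1) • (-2 : ℝ) • ContinuousLinearMap.fst ℝ ℝ ℝ) q :=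
        (hasFDerivAt_fst.const_mul (-2)).exp.const_mul p
      refine ((euler_logPolar hu heuler hq).2.sub hexp).congr_fderiv ?_
      have h1 : partialFst (closedRect 0 (Real.log 2) θ₀) (logPolar uθ) q = 0 :=
        (partialFst_congr hv hqR).trans (by simp [partialFst])
      have h2 : partialSnd (closedRect 0 (Real.log 2) θ₀) (logPolar uθ) q = 0 :=
        (partialSnd_congr hv hqR).trans (by simp [partialSnd])
      have h3 : partialFst (closedRect 0 (Real.log 2) θ₀) (logPolar ur) q = 0 := by
        have := (euler_logPolar hu heuler hq).1
        linarith
      have h4 := hode q hqR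
      have h5 := hv q hqR
      ext
      · simp [pressureFst, h3, h5]
        linear_combination (-Real.exp (-(2 * q.1))) * h4
      · simp [pressureSnd, h1, h2, h5]
        ring
    exact isOpen_openRect.exists_is_const_of_fderiv_eq_zero
      (isPreconnected_Ioo.prod isPreconnected_Ioo)
      (fun q hq => (hder q hq).differentiableAt.differentiableWithinAt)
      (fun q hq => (hder q hq).fderiv)
  have hPform : ∀ q ∈ openRect 1 2 θ₀, P (polarPoint q) = p / q.1 ^ 2 + C := by
    rintro ⟨r, θ⟩ ⟨hr, hθ⟩
    have hr0 : (0 : ℝ) < r := one_pos.trans hr.1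
    have h := hC (Real.log r, θ) ⟨log_mem_Ioo hr, hθ⟩
    have h2 : Real.exp (-2 * Real.log r) = (r ^ 2)⁻¹ := by
      rw [← Real.exp_log (pow_pos hr0 2), ← Real.exp_neg, Real.log_pow]; push_cast; ring_nf
    simp only [Real.exp_log hr0, h2] at h
    rw [div_eq_mul_inv]
    linarith
  refine ⟨?_, hform, C, ?_, hPform⟩
  · rintro _ ⟨q, hq, rfl⟩ t ht ⟨q', hq', h⟩
    have hqq := polarPoint_smul_eq one_pos hθ₀' hq hq' ht h.symm
    have hr0 : 0 < q.1 := one_pos.trans hq.1.1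
    rw [← h, hux q' hq', hux q hq, hqq, smul_add, smul_smul, smul_smul, zpow_neg_one]
    congr 2 <;> field_simp
  · rintro _ ⟨q, hq, rfl⟩ t ht ⟨q', hq', h⟩
    have hqq := polarPoint_smul_eq one_pos hθ₀' hq hq' ht h.symm
    have hr0 : 0 < q.1 := one_pos.trans hq.1.1
    have h' := hPform q' hq'
    simp only [← h, h', hPform q hq, smul_eq_mul, add_sub_cancel_right]
    rw [hqq, zpow_neg, zpow_ofNat]
    field_simp

end Euler

theorem theorem1 (θ₀ : ℝ) (hθ₀ : 0 < θ₀) (hθ₀' : θ₀ ≤ 2 * Real.pi)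
    (u : Plane → Plane) (P : Plane → ℝ) (ur uθ : ℝ × ℝ → ℝ)
    (hu : IsC2WithPolarComponents 1 2 θ₀ u ur uθ)
    (heuler : IsEulerSolution (sector 1 2 θ₀) u P)
    (hur : ∀ q ∈ closedRect 1 2 θ₀, 0 < |ur q|)
    (c₁ c₂ : ℝ)
    (hbot : ∀ r ∈ Set.Icc (1 : ℝ) 2, uθ (r, 0) = c₁ / r)
    (htop : ∀ r ∈ Set.Icc (1 : ℝ) 2, uθ (r, θ₀) = c₂ / r)
    (hper_r : ∀ θ ∈ Set.Icc 0 θ₀, ur (1, θ) = 2 * ur (2, θ))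
    (hper_θ : ∀ θ ∈ Set.Icc 0 θ₀, uθ (1, θ) = 2 * uθ (2, θ))
    (hper_d : ∀ θ ∈ Set.Icc 0 θ₀,
      derivWithin (fun r => uθ (r, θ)) (Set.Icc 1 2) 1 =
        2 ^ 2 * derivWithin (fun r => uθ (r, θ)) (Set.Icc 1 2) 2) :
    c₁ = c₂ ∧
    (c₁ = 0 → ∃ b : ℝ, b ≠ 0 ∧
      HasHomogeneousForm 1 2 θ₀ u ur uθ P (fun _ => 0) (fun _ => b) (-b ^ 2 / 2)) ∧
    (c₁ ≠ 0 →
      ((∃ A : ℝ, ∀ r ∈ Set.Icc (1 : ℝ) 2,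
          derivWithin (fun θ => r * ur (r, θ)) (Set.Icc 0 θ₀) 0 = A) ∨
        (∃ A : ℝ, ∀ r ∈ Set.Icc (1 : ℝ) 2,
          derivWithin (fun θ => r * ur (r, θ)) (Set.Icc 0 θ₀) θ₀ = A)) →
      ∃ (f : ℝ → ℝ) (p : ℝ),
        ContDiffOn ℝ 2 f (Set.Icc 0 θ₀) ∧
        ((∀ θ ∈ Set.Icc 0 θ₀, 0 < f θ) ∨ (∀ θ ∈ Set.Icc 0 θ₀, f θ < 0)) ∧
        (∀ θ ∈ Set.Icc 0 θ₀,
          c₁ * derivWithin f (Set.Icc 0 θ₀) θ = f θ ^ 2 + c₁ ^ 2 + 2 * p) ∧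
        HasHomogeneousForm 1 2 θ₀ u ur uθ P (fun _ => c₁) f p) := by
  have hT : 0 < Real.log 2 := Real.log_pos one_lt_two
  have h0T : (0 : ℝ) ∈ Set.Icc 0 (Real.log 2) := ⟨le_rfl, hT.le⟩
  have H := isPeriodicFlow_logPolar hθ₀ hu heuler hur hbot htop hper_r hper_θ hper_d
  obtain rfl := H.edge_values_eq hT hθ₀
  refine ⟨rfl, ?_, ?_⟩
  · rintro rfl
    have hv := H.v_eq_zero hT hθ₀
    obtain ⟨-, p, hp⟩ := H.profile hT hθ₀ hv
    have hw : ∀ q ∈ closedRect 0 (Real.log 2) θ₀, logPolar ur q = logPolar ur (0, 0) :=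
      fun q hq => H.w_eq_const hT hθ₀ hq
    have h00 : ((0 : ℝ), (0 : ℝ)) ∈ closedRect 0 (Real.log 2) θ₀ := ⟨h0T, le_rfl, hθ₀.le⟩
    -- The profile equation with c = 0 is w² + 2p = 0.
    have hpb : p = -logPolar ur (0, 0) ^ 2 / 2 := by linarith [hp _ h00]
    refine ⟨logPolar ur (0, 0), H.ne_zero _ h00, ?_⟩
    exact hasHomogeneousForm_of_logPolar hθ₀' hu heuler hv hw (hpb ▸ hp)
  · intro hc hedge
    have hedge' : (∃ A, ∀ t ∈ Set.Icc 0 (Real.log 2),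
          partialSnd (closedRect 0 (Real.log 2) θ₀) (logPolar ur) (t, 0) = A) ∨
        ∃ A, ∀ t ∈ Set.Icc 0 (Real.log 2),
          partialSnd (closedRect 0 (Real.log 2) θ₀) (logPolar ur) (t, θ₀) = A := by
      refine hedge.imp ?_ ?_ <;> rintro ⟨A, hA⟩ <;> refine ⟨A, fun t ht => ?_⟩
      · rw [partialSnd_logPolar hθ₀ hu.1 ht ⟨le_rfl, hθ₀.le⟩]
        exact hA _ (exp_mem_Icc ht)
      · rw [partialSnd_logPolar hθ₀ hu.1 ht ⟨hθ₀.le, le_rfl⟩]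
        exact hA _ (exp_mem_Icc ht)
    have hv := H.v_eq_const hT hθ₀ hc hedge'
    obtain ⟨hw, p, hp⟩ := H.profile hT hθ₀ hv
    refine ⟨fun θ => logPolar ur (0, θ), p, ?_, ?_, ?_, ?_⟩
    · exact H.contDiffOn_w.comp (contDiff_const.prodMk contDiff_id).contDiffOn
        fun θ hθ => ⟨h0T, hθ⟩
    · exact (pos_or_neg_of_ne_zero isPreconnected_closedRect H.contDiffOn_w.continuousOn
        H.ne_zero).imp (fun h θ hθ => h (0, θ) ⟨h0T, hθ⟩) (fun h θ hθ => h (0, θ) ⟨h0T, hθ⟩)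
    · intro θ hθ
      have hd := hasDerivWithinAt_snd (H.contDiffOn_w.differentiableOn two_ne_zero)
        (q := (0, θ)) ⟨h0T, hθ⟩
      rw [hd.derivWithin (uniqueDiffOn_Icc hθ₀ θ hθ)]
      exact hp (0, θ) ⟨h0T, hθ⟩
    · exact hasHomogeneousForm_of_logPolar hθ₀' hu heuler hv hw hp
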